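/- **Theorem 3.2.** Let $p,t\in\mathbb{C}^*$ with $|p|<1$, $|t|<1$, let $s\ge 2$, $n\ge 1$, $m=2s+2$, and $a=(a_1,\dots,a_m)\in(\mathbb{C}^*)^m$. Write $\theta(u)=\prod_{i\ge0}(1-p^iu)(1-p^{i+1}/u)$ and $e(u,v)=u^{-1}\theta(uv)\theta(u/v)$. For $d\ge 0$ let $\mathcal{H}_{d,n}$ be the $\mathbb{C}$-vector space of holomorphic functions $f$ on $(\mathbb{C}^*)^n$ that are invariant under permutations and inversions $z_i\mapsto z_i^{-1}$ of the coordinates and satisfy $f(z_1,\dots,pz_i,\dots,z_n)=f(z)\,(pz_i^2)^{-d}$ for $i=1,\dots,n$ (for $n=0$, $\mathcal{H}_{d,0}=\mathbb{C}$). Let $Z_{s,n}=\{\mu\in\mathbb{N}^s:\ \mu_1+\dots+\mu_s=n\}$. For $c\in(\mathbb{C}^*)^s$ and $\mu\in Z_{s,n}$ put $(c)_{t,\mu}=(c_1,tc_1,\dots,t^{\mu_1-1}c_1,\dots,c_s,tc_s,\dots,t^{\mu_s-1}c_s)$; the interpolation basis $\{E_\mu(c;z)\}_{\mu\in Z_{s,n}}$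 of $\mathcal{H}_{s-1,n}$ is the basis with $E_\mu(c;(c)_{t,\nu})=\delta_{\mu,\nu}$ for $\mu,\nu\in Z_{s,n}$. Finally let $$f_i^{+}(z)=\frac{\prod_{k=1}^{m}\theta(a_kz_i)}{z_i^{s}\theta(z_i^2)}\prod_{1\le j\le n,\,j\ne i}\frac{\theta(tz_iz_j)\theta(tz_i/z_j)}{\theta(z_iz_j)\theta(z_i/z_j)},\qquad f_i^{-}(z)=f_i^{+}(z^{-1}).$$ Assume the balancing condition $t^{2n-2}a_1\cdots a_m=1$, and assume that the parameters are generic in the sense that * $\theta(t^j)\neq0$ for $1\le j\le n$; * $e(t^ia_k,t^ja_l)\neq0$ for $1\le k<l\le s$ and all integers $i,j\ge0$ with $i+j<n$; * $\theta(t^ua_sa_k)\ne0$ for $s+1\le k\le m$ and $0\le u<n$. Then: 1. $\mathcal{H}_{s-2,n}$ has a unique interpolation basis $\{E_{\nu'}(a_1,\dots,a_{s-1};z)\}_{\nu'\in Z_{s-1,n}}$ with respect to $(a_1,\dots,a_{s-1})$. 2. There is a unique $\mathbb{C}$-linear map $\nabla^{\Psi}_{\mathrm{sym}}:\mathcal{H}_{s-1,n-1}\to\mathcal{H}_{s-1,n}$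 with $$(\nabla^{\Psi}_{\mathrm{sym}}\varphi)(z)=\sum_{i=1}^{n}\big(f_i^{+}(z)+f_i^{-}(z)\big)\,\varphi(z_1,\dots,z_{i-1},z_{i+1},\dots,z_n)$$ at all $z$ where no denominator of the $f_i^{\pm}$ vanishes. 3. The functions $E_{\nu'}(a_1,\dots,a_{s-1};z)\prod_{i=1}^n e(z_i,a_s)$ $(\nu'\in Z_{s-1,n})$ lie in $\mathcal{H}_{s-1,n}$, and their classes form a $\mathbb{C}$-basis of the cokernel $H^{\Psi}_{\mathrm{sym}}=\mathcal{H}_{s-1,n}/\nabla^{\Psi}_{\mathrm{sym}}\mathcal{H}_{s-1,n-1}$. In particular $\dim_{\mathbb{C}}H^{\Psi}_{\mathrm{sym}}=\binom{n+s-2}{s-2}$. -/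

import Mathlib

/-! Elliptic interpolation functions of type `BC_n` and the symmetrized coboundary operator.

The torus `(ℂ*)^n` is `Fin n → ℂˣ`; indices are counted from `0`. -/

noncomputable section

namespace EllipticBC

/-- The multiplicative theta function `θ(u;p) = (u;p)_∞ (p/u;p)_∞`. -/
def theta (p u : ℂˣ) : ℂ :=
  (∏' i : ℕ, (1 - (p : ℂ) ^ i * (u : ℂ))) *
    ∏' i : ℕ, (1 - (p : ℂ) ^ i * ((p : ℂ) / (u : ℂ)))

/-- `e(u,v;p) = u⁻¹ θ(uv;p) θ(u/v;p)`. -/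
def e (p u v : ℂˣ) : ℂ :=
  (u : ℂ)⁻¹ * theta p (u * v) * theta p (u * v⁻¹)

/-- Holomorphy of a function on `(ℂ*)^n`, expressed in the coordinates of `ℂ^n`. -/
def IsHolomorphic {n : ℕ} (f : (Fin n → ℂˣ) → ℂ) : Prop :=
  ∃ F : (Fin n → ℂ) → ℂ, DifferentiableOn ℂ F {z | ∀ i, z i ≠ 0} ∧
    ∀ z : Fin n → ℂˣ, F (fun i => (z i : ℂ)) = f z

/-- The space `H_{d,n}^{(p)}` of holomorphic functions on `(ℂ*)^n` that are invariant under
permutations and inversions of the coordinates and quasi-periodic of degree `d`: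
`f(z_1,…,p z_i,…,z_n) = f(z) (p z_i²)^{-d}`. -/
def H (p : ℂˣ) (d n : ℕ) : Submodule ℂ ((Fin n → ℂˣ) → ℂ) where
  carrier := {f | IsHolomorphic f ∧
    (∀ (σ : Equiv.Perm (Fin n)) (z : Fin n → ℂˣ), f (fun i => z (σ i)) = f z) ∧
    (∀ (i : Fin n) (z : Fin n → ℂˣ), f (Function.update z i (z i)⁻¹) = f z) ∧
    ∀ (i : Fin n) (z : Fin n → ℂˣ),
      f (Function.update z i (p * z i)) = f z * ((p : ℂ) * (z i : ℂ) ^ 2) ^ (-(d : ℤ))}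
  add_mem' := by
    rintro f g ⟨⟨F, hF, hF'⟩, hf1, hf2, hf3⟩ ⟨⟨G, hG, hG'⟩, hg1, hg2, hg3⟩
    refine ⟨⟨F + G, hF.add hG, fun z => by simp [hF', hG']⟩, fun σ z => ?_, fun i z => ?_,
      fun i z => ?_⟩
    · simp only [Pi.add_apply, hf1, hg1]
    · simp only [Pi.add_apply, hf2, hg2]
    · simp only [Pi.add_apply, hf3, hg3, add_mul]
  zero_mem' := ⟨⟨0, differentiableOn_const 0, fun _ => rfl⟩, by simp, by simp, by simp⟩
  smul_mem' := by
    rintro c f ⟨⟨F, hF, hF'⟩, hf1, hf2, hf3⟩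
    refine ⟨⟨c • F, hF.const_smul c, fun z => by simp [hF']⟩, fun σ z => ?_, fun i z => ?_,
      fun i z => ?_⟩
    · simp only [Pi.smul_apply, hf1]
    · simp only [Pi.smul_apply, hf2]
    · simp only [Pi.smul_apply, hf3, smul_eq_mul, mul_assoc]

/-- `Z_{s,n}`: the multi-indices `μ ∈ ℕ^s` with `|μ| = n`. -/
def Z (s n : ℕ) : Type := {μ : Fin s → ℕ // ∑ k, μ k = n}

/-- The reference point
`(c)_{t,μ} = (c_1, t c_1, …, t^{μ_1-1} c_1, …, c_s, t c_s, …, t^{μ_s-1} c_s)`. -/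
def refPoint {s n : ℕ} (t : ℂˣ) (c : Fin s → ℂˣ) (μ : Z s n) : Fin n → ℂˣ :=
  fun i =>
    let x := (finSigmaFinEquiv (n := μ.1)).symm (Fin.cast μ.2.symm i)
    t ^ (x.2 : ℕ) * c x.1

/-- `E` is the interpolation basis `{E_μ(c;z;p)}` of `H_{d,n}^{(p)}`, i.e. a basis with
`E_μ(c;(c)_{t,ν};p) = δ_{μ,ν}` (to be used with `d = s - 1`). -/
def IsInterpolationBasis {p : ℂˣ} {s d n : ℕ} (t : ℂˣ) (c : Fin s → ℂˣ)
    (E : Module.Basis (Z s n) ℂ (H p d n)) : Prop :=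
  ∀ μ ν : Z s n, (μ = ν → (E μ).1 (refPoint t c ν) = 1) ∧
    (μ ≠ ν → (E μ).1 (refPoint t c ν) = 0)

/-- Genericity of the parameters `c = (c_1,…,c_s)` for interpolation in `n` variables. -/
def IsGeneric {s : ℕ} (p t : ℂˣ) (n : ℕ) (c : Fin s → ℂˣ) : Prop :=
  ∀ k l : Fin s, k < l → ∀ i j : ℕ, i + j < n → e p (t ^ i * c k) (t ^ j * c l) ≠ 0

/-- The first `s` of the parameters `a_1,…,a_m`. -/
def initial {m : ℕ} (s : ℕ) (h : s ≤ m) (a : Fin m → ℂˣ) : Fin s → ℂˣ :=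
  fun k => a (Fin.castLE h k)

/-- The meromorphic function
`f_i^+(z) = ∏_k θ(a_k z_i) / (z_i^s θ(z_i²)) ∏_{j ≠ i} θ(t z_i z_j^{±1}) / θ(z_i z_j^{±1})`,
meaningful at the points where the denominator does not vanish. -/
def fPlus {m n : ℕ} (s : ℕ) (p t : ℂˣ) (a : Fin m → ℂˣ) (i : Fin n) (z : Fin n → ℂˣ) : ℂ :=
  (∏ k, theta p (a k * z i)) / ((z i : ℂ) ^ s * theta p (z i ^ 2)) *
    ∏ j ∈ Finset.univ.erase i,
      (theta p (t * z i * z j) * theta p (t * z i * (z j)⁻¹)) /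
        (theta p (z i * z j) * theta p (z i * (z j)⁻¹))

/-- `f_i^-(z) = f_i^+(z⁻¹)`. -/
def fMinus {m n : ℕ} (s : ℕ) (p t : ℂˣ) (a : Fin m → ℂˣ) (i : Fin n) (z : Fin n → ℂˣ) : ℂ :=
  fPlus s p t a i (fun j => (z j)⁻¹)

/-- The points at which no denominator of the functions `f_i^±` vanishes. The set of these points
is open and dense in `(ℂ*)^n` if `|p| < 1`. -/
def IsRegular {n : ℕ} (p : ℂˣ) (z : Fin n → ℂˣ) : Prop :=
  (∀ i, theta p (z i ^ 2) ≠ 0) ∧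
    ∀ i j, i ≠ j → theta p (z i * z j) ≠ 0 ∧ theta p (z i * (z j)⁻¹) ≠ 0

/-- `D` is the symmetrized coboundary operator `∇_sym^Ψ : H_{s-1,n} → H_{s-1,n+1}` (here with
`n + 1` in place of `n`),
`(∇_sym^Ψ φ)(z) = ∑_i (f_i^+(z) + f_i^-(z)) φ(z_1,…,z_{i-1},z_{i+1},…,z_{n+1})`,
an identity of meromorphic functions. -/
def IsSymCoboundary {m n : ℕ} (s : ℕ) (p t : ℂˣ) (a : Fin m → ℂˣ)
    (D : H p (s - 1) n →ₗ[ℂ] H p (s - 1) (n + 1)) : Prop :=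
  ∀ (φ : H p (s - 1) n) (z : Fin (n + 1) → ℂˣ), IsRegular p z →
    (D φ).1 z = ∑ i, (fPlus s p t a i z + fMinus s p t a i z) * φ.1 (Fin.removeNth i z)

/-- The cokernel `H_sym^Ψ` of the symmetrized coboundary operator. -/
abbrev Cohomology {p : ℂˣ} {d n : ℕ} (D : H p d n →ₗ[ℂ] H p d (n + 1)) : Type :=
  H p d (n + 1) ⧸ LinearMap.range D

end EllipticBC

end

/-! Write ∇ for the coboundary operator. Functions of degree s-1 that vanish wherever some z_i = a_s
are exactly the multiples of ∏ e(z_i, a_s) by functions of degree s-2, and Pascal's rule gives dim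
H_{s-1,n} = dim H_{s-1,n-1} + dim H_{s-2,n}. Hence it suffices to show that φ = 0 whenever ∇φ
vanishes on the locus z_i = a_s (`eq_zero_of_symCoboundary_eq_zero`). Then ∇ is injective, its image
meets the multiples of ∏ e(z_i, a_s) only in 0, and the dimensions make the two subspaces
complementary (`bijective_mkQ_mulProdE`).

To see that φ = 0, evaluate ∇φ at the reference points built from a_1, …, a_s. There every f_i^-
vanishes, and f_i^+ vanishes unless position i ends its string, so ∇φ at ν is a combination of the
values of φ at ν - ε_k. For ν = μ + ε_s the coefficient of φ at μ is nonzero by genericity, and the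
other multi-indices have a larger last entry. Downward induction on μ_s kills all values of φ, and
interpolation gives φ = 0. Genericity does not prevent θ(z_i z_j) from vanishing at a reference
point, so the evaluation is first done for deformed parameters and then extended by density and
continuity (`symCoboundary_refPoint`).

Interpolation rests on theta functions of one variable: quasi-periodicity is a recursion for Laurent
coefficients that bounds dimensions, and Lagrange products attain the bounds (`Th.eq_zero_even`,
`Th.eq_zero_odd`). Arguing one variable at a time, functions of several variables are determined by
their values on a grid. Dividing out ∏ e(z_i, c) and restricting to z_i = c then give interpolation
at reference points by double induction (`eq_zero_of_refPoint`).

For the existence of ∇, multiplication by the Vandermonde function `vand` clears all denominators.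
By the balancing condition the result is an odd theta function in each variable, so it can be
compared on a grid with `vand` times a function interpolating the coboundary at regular points
(`exists_symCoboundary`). No analysis of poles is needed. -/

noncomputable section
namespace EllipticBC
open Filter Topology Function Complex

/-! ### The theta function -/

/-- Holomorphy of a function on the punctured plane. -/
def IsHol (f : ℂˣ → ℂ) : Prop :=
  ∃ F : ℂ → ℂ, DifferentiableOn ℂ F {0}ᶜ ∧ ∀ x : ℂˣ, F x = f x

lemma isHol_const (c : ℂ) : IsHol fun _ => c := ⟨fun _ => c, differentiableOn_const c, fun _ => rfl⟩

lemma IsHol.add {f g : ℂˣ → ℂ} (hf : IsHol f) (hg : IsHol g) : IsHol fun x => f x + g x := by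
  obtain ⟨F, hF, hF'⟩ := hf
  obtain ⟨G, hG, hG'⟩ := hg
  exact ⟨F + G, hF.add hG, fun x => by simp [hF', hG']⟩

lemma IsHol.mul {f g : ℂˣ → ℂ} (hf : IsHol f) (hg : IsHol g) : IsHol fun x => f x * g x := by
  obtain ⟨F, hF, hF'⟩ := hf
  obtain ⟨G, hG, hG'⟩ := hg
  exact ⟨F * G, hF.mul hG, fun x => by simp [hF', hG']⟩

lemma IsHol.const_mul {f : ℂˣ → ℂ} (hf : IsHol f) (c : ℂ) : IsHol fun x => c * f x :=
  (isHol_const c).mul hf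

lemma IsHol.sub {f g : ℂˣ → ℂ} (hf : IsHol f) (hg : IsHol g) : IsHol fun x => f x - g x := by
  simpa [sub_eq_add_neg] using hf.add (hg.const_mul (-1))

lemma IsHol.prod {ι : Type*} (s : Finset ι) {f : ι → ℂˣ → ℂ} (hf : ∀ i ∈ s, IsHol (f i)) :
    IsHol fun x => ∏ i ∈ s, f i x := by
  classical
  induction s using Finset.induction_on with
  | empty => simpa using isHol_const 1
  | insert a s ha ih =>
    simp only [Finset.prod_insert ha]
    exact (hf a (by simp)).mul (ih fun i hi => hf i (by simp [hi]))

lemma IsHol.comp_inv {f : ℂˣ → ℂ} (hf : IsHol f) : IsHol fun x => f x⁻¹ := by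
  obtain ⟨F, hF, hF'⟩ := hf
  refine ⟨fun z => F z⁻¹, hF.comp (fun z hz => (differentiableAt_inv hz).differentiableWithinAt)
    fun z hz => by simpa using hz, fun x => by simp [← hF']⟩

lemma IsHol.comp_mul_left {f : ℂˣ → ℂ} (hf : IsHol f) (c : ℂˣ) : IsHol fun x => f (c * x) := by
  obtain ⟨F, hF, hF'⟩ := hf
  refine ⟨fun z => F (c * z), hF.comp (by fun_prop)
    fun z hz => by simpa using hz, fun x => by simp [← hF']⟩

lemma IsHol.comp_mul_right {f : ℂˣ → ℂ} (hf : IsHol f) (c : ℂˣ) : IsHol fun x => f (x * c) := by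
  simpa [mul_comm] using hf.comp_mul_left c

lemma IsHol.comp_sq {f : ℂˣ → ℂ} (hf : IsHol f) : IsHol fun x => f (x ^ 2) := by
  obtain ⟨F, hF, hF'⟩ := hf
  refine ⟨fun z => F (z ^ 2), hF.comp (by fun_prop)
    fun z hz => by simpa using hz, fun x => by simp [← hF']⟩

lemma isHol_inv_pow (k : ℕ) : IsHol fun x => ((x : ℂ) ^ k)⁻¹ :=
  ⟨fun z => (z ^ k)⁻¹, DifferentiableOn.inv (by fun_prop) fun z hz => pow_ne_zero _ (by simpa using hz),
    fun _ => rfl⟩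

lemma IsHol.continuous {f : ℂˣ → ℂ} (hf : IsHol f) : Continuous f := by
  obtain ⟨F, hF, hF'⟩ := hf
  have : f = fun x : ℂˣ => F x := by ext x; rw [hF']
  rw [this]
  exact hF.continuousOn.comp_continuous Units.continuous_val fun x => by simp

/-- The nonvanishing locus of a holomorphic function that is not identically zero is dense. -/
lemma IsHol.dense_ne_zero {f : ℂˣ → ℂ} (hf : IsHol f) (h0 : ∃ x, f x ≠ 0) : Dense {x | f x ≠ 0} := by
  obtain ⟨F, hF, hF'⟩ := hf
  obtain ⟨x₀, hx₀⟩ := h0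
  have hopen : IsOpen ({0}ᶜ : Set ℂ) := isOpen_compl_singleton
  have hpre : IsPreconnected ({0}ᶜ : Set ℂ) :=
    (isConnected_compl_singleton_of_one_lt_rank (by simp) 0).isPreconnected
  intro x
  rw [mem_closure_iff_frequently]
  by_contra hx
  rw [not_frequently] at hx
  have hx' : ∀ᶠ z in 𝓝 (x : ℂ), F z = 0 := by
    rw [← Units.isOpenEmbedding_val.map_nhds_eq x, eventually_map]
    filter_upwards [hx] with y hy
    simpa [hF'] using hy
  have := (hF.analyticOnNhd hopen).eqOn_zero_of_preconnected_of_eventuallyEq_zero hpre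
    (show (x : ℂ) ∈ ({0}ᶜ : Set ℂ) by simp) hx'
  exact hx₀ (by rw [← hF']; exact this (by simp))

lemma dense_forall_ne_zero {ι : Type*} (s : Finset ι) {f : ι → ℂˣ → ℂ}
    (hf : ∀ i ∈ s, IsHol (f i)) (h0 : ∀ i ∈ s, ∃ x, f i x ≠ 0) :
    Dense {x | ∀ i ∈ s, f i x ≠ 0} := by
  classical
  induction s using Finset.induction_on with
  | empty => simp
  | insert a s ha ih =>
    have h1 := ih (fun i hi => hf i (by simp [hi])) (fun i hi => h0 i (by simp [hi]))
    have ha1 := hf a (by simp)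
    have : {x | ∀ i ∈ insert a s, f i x ≠ 0} = {x | f a x ≠ 0} ∩ {x | ∀ i ∈ s, f i x ≠ 0} := by
      ext x; simp
    rw [this]
    exact (ha1.dense_ne_zero (h0 a (by simp))).inter_of_isOpen_left h1
      (isOpen_ne_fun ha1.continuous continuous_const)

section ThetaBasics

variable {p : ℂˣ} (hp : ‖(p : ℂ)‖ < 1)
include hp

lemma summable_norm_geometric : Summable fun i : ℕ => ‖(p : ℂ)‖ ^ i :=
  summable_geometric_of_lt_one (norm_nonneg _) hp

lemma multipliable_one_sub_pow_mul (u : ℂ) :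
    Multipliable fun i : ℕ => 1 - (p : ℂ) ^ i * u := by
  simp_rw [sub_eq_add_neg]
  apply multipliable_one_add_of_summable
  simpa using (summable_norm_geometric hp).mul_right ‖u‖

lemma tprod_one_sub_pow_mul (u : ℂ) :
    ∏' i : ℕ, (1 - (p : ℂ) ^ i * u) = (1 - u) * ∏' i : ℕ, (1 - (p : ℂ) ^ i * (p * u)) := by
  rw [tprod_eq_zero_mul']
  · simp [pow_succ, mul_assoc]
  · simpa [pow_succ, mul_assoc] using multipliable_one_sub_pow_mul hp (p * u)

lemma differentiable_tprod_one_sub_pow_mul :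
    Differentiable ℂ fun u : ℂ => ∏' i : ℕ, (1 - (p : ℂ) ^ i * u) := by
  rw [← differentiableOn_univ]
  have h : HasProdLocallyUniformlyOn (fun (i : ℕ) (u : ℂ) => 1 + -((p : ℂ) ^ i * u))
      (fun u => ∏' i : ℕ, (1 + -((p : ℂ) ^ i * u))) Set.univ := by
    apply hasProdLocallyUniformlyOn_of_forall_compact isOpen_univ
    intro K _ hK
    obtain ⟨C, hC⟩ := hK.isBounded.exists_norm_le
    refine ((summable_norm_geometric hp).mul_right C).hasProdUniformlyOn_nat_one_add hK
      (.of_forall fun i x hx => ?_) (fun _ => by fun_prop)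
    simpa using mul_le_mul_of_nonneg_left (hC x hx) (pow_nonneg (norm_nonneg (p : ℂ)) i)
  simp_rw [sub_eq_add_neg]
  exact h.differentiableOn (.of_forall fun _ => by
    simpa [Finset.prod_fn] using DifferentiableOn.finsetProd (fun _ _ => by fun_prop)) isOpen_univ

omit hp in
lemma theta_one : theta p 1 = 0 := by
  have : ∏' i : ℕ, (1 - (p : ℂ) ^ i * ((1 : ℂˣ) : ℂ)) = 0 := by
    refine tprod_of_exists_eq_zero ⟨0, by simp⟩
  rw [theta, this, zero_mul]

/-- Once 1 - u is split off, the two remaining products are exchanged by u ↦ 1/u, which makes the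
inversion formula immediate. -/
lemma theta_eq (u : ℂˣ) : theta p u = (1 - (u : ℂ)) *
    ((∏' i : ℕ, (1 - (p : ℂ) ^ i * (p * (u : ℂ)))) * ∏' i : ℕ, (1 - (p : ℂ) ^ i * (p * (u : ℂ)⁻¹))) := by
  rw [theta, tprod_one_sub_pow_mul hp, div_eq_mul_inv, mul_assoc]

lemma theta_inv (u : ℂˣ) : theta p u⁻¹ = -(u : ℂ)⁻¹ * theta p u := by
  rw [theta_eq hp, theta_eq hp]
  simp only [Units.val_inv_eq_inv_val, inv_inv]
  generalize ∏' i : ℕ, (1 - (p : ℂ) ^ i * (p * (u : ℂ))) = A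
  generalize ∏' i : ℕ, (1 - (p : ℂ) ^ i * (p * (u : ℂ)⁻¹)) = B
  have := u.ne_zero
  field_simp
  ring

lemma theta_p_mul (u : ℂˣ) : theta p (p * u) = -(u : ℂ)⁻¹ * theta p u := by
  have h : (p : ℂ) / ((p * u : ℂˣ) : ℂ) = (u : ℂ)⁻¹ := by
    have := u.ne_zero; have := p.ne_zero; push_cast; field_simp
  rw [theta_eq hp u, theta, h, tprod_one_sub_pow_mul hp (u : ℂ)⁻¹]
  simp only [Units.val_mul]
  generalize ∏' i : ℕ, (1 - (p : ℂ) ^ i * (p * (u : ℂ))) = A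
  generalize ∏' i : ℕ, (1 - (p : ℂ) ^ i * (p * (u : ℂ)⁻¹)) = B
  have := u.ne_zero
  field_simp
  ring

lemma isHol_theta : IsHol (theta p) := by
  have hd := differentiable_tprod_one_sub_pow_mul hp
  refine ⟨fun u => (∏' i : ℕ, (1 - (p : ℂ) ^ i * u)) * ∏' i : ℕ, (1 - (p : ℂ) ^ i * (p / u)), ?_,
    fun u => rfl⟩
  refine hd.differentiableOn.mul (hd.comp_differentiableOn ?_)
  intro z hz
  have hz : z ≠ 0 := hz
  exact (DifferentiableAt.div (by fun_prop) (by fun_prop) hz).differentiableWithinAt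

lemma continuous_theta : Continuous (theta p) := (isHol_theta hp).continuous

lemma e_inv_left (u v : ℂˣ) : e p u⁻¹ v = e p u v := by
  have h1 : u⁻¹ * v = (u * v⁻¹)⁻¹ := by simp [mul_comm]
  have h2 : u⁻¹ * v⁻¹ = (u * v)⁻¹ := by simp [mul_comm]
  rw [e, e, h1, h2, theta_inv hp, theta_inv hp]
  have := u.ne_zero; have := v.ne_zero
  push_cast
  field_simp

lemma e_swap (u v : ℂˣ) : e p u v = -e p v u := by
  have h1 : u * v⁻¹ = (v * u⁻¹)⁻¹ := by simp
  rw [e, e, h1, theta_inv hp, mul_comm u v]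
  have := u.ne_zero; have := v.ne_zero
  push_cast
  field_simp

omit hp in
lemma e_self (u : ℂˣ) : e p u u = 0 := by simp [e, theta_one]

lemma e_p_mul (u v : ℂˣ) : e p (p * u) v = e p u v * ((p : ℂ) * (u : ℂ) ^ 2)⁻¹ := by
  rw [e, e, mul_assoc p, mul_assoc p, theta_p_mul hp, theta_p_mul hp]
  have := u.ne_zero; have := v.ne_zero; have := p.ne_zero
  push_cast
  field_simp

lemma isHol_e (v : ℂˣ) : IsHol fun u => e p u v := by
  have h1 := (isHol_theta hp).comp_mul_right v
  have h2 := (isHol_theta hp).comp_mul_right v⁻¹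
  simpa [e] using ((isHol_inv_pow 1).mul h1).mul h2

omit hp in
lemma e_ne_zero_iff (u v : ℂˣ) :
    e p u v ≠ 0 ↔ theta p (u * v) ≠ 0 ∧ theta p (u * v⁻¹) ≠ 0 := by
  simp [e, not_or]

end ThetaBasics

open MeasureTheory

/-! ### Theta functions of one variable -/

/-- Holomorphic functions `f` on `ℂ*` with `f(1/x) = ε f(x)` and `f(px) = f(x) (p x²)^{-D}`. -/
def Th (p : ℂˣ) (ε : ℂ) (D : ℕ) : Submodule ℂ (ℂˣ → ℂ) where
  carrier := {f | IsHol f ∧ (∀ x, f x⁻¹ = ε * f x) ∧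
    ∀ x, f (p * x) = f x * ((p : ℂ) * (x : ℂ) ^ 2) ^ (-(D : ℤ))}
  add_mem' := by
    rintro f g ⟨hf, hf1, hf2⟩ ⟨hg, hg1, hg2⟩
    refine ⟨hf.add hg, fun x => ?_, fun x => ?_⟩
    · simp only [Pi.add_apply, hf1, hg1, mul_add]
    · simp only [Pi.add_apply, hf2, hg2, add_mul]
  zero_mem' := ⟨isHol_const 0, by simp, by simp⟩
  smul_mem' := by
    rintro c f ⟨hf, hf1, hf2⟩
    refine ⟨hf.const_mul c, fun x => ?_, fun x => ?_⟩
    · simp only [Pi.smul_apply, hf1, smul_eq_mul]; ring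
    · simp only [Pi.smul_apply, hf2, smul_eq_mul]; ring

lemma Th.mul {p : ℂˣ} {ε ε' : ℂ} {D D' : ℕ} {f g : ℂˣ → ℂ} (hf : f ∈ Th p ε D)
    (hg : g ∈ Th p ε' D') : (fun x => f x * g x) ∈ Th p (ε * ε') (D + D') := by
  obtain ⟨hf, hf1, hf2⟩ := hf
  obtain ⟨hg, hg1, hg2⟩ := hg
  refine ⟨hf.mul hg, fun x => ?_, fun x => ?_⟩
  · simp only [hf1, hg1]; ring
  · simp only [hf2, hg2]
    have h : (p : ℂ) * (x : ℂ) ^ 2 ≠ 0 := by simp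
    push_cast
    rw [neg_add, zpow_add₀ h]
    ring

lemma Th.const (p : ℂˣ) (c : ℂ) : (fun _ => c) ∈ Th p 1 0 :=
  ⟨isHol_const c, by simp, by simp⟩

lemma Th.prod {p : ℂˣ} {ι : Type*} (s : Finset ι) {D : ℕ} {f : ι → ℂˣ → ℂ}
    (hf : ∀ i ∈ s, f i ∈ Th p 1 D) : (fun x => ∏ i ∈ s, f i x) ∈ Th p 1 (s.card * D) := by
  classical
  induction s using Finset.induction_on with
  | empty => simpa using Th.const p 1
  | insert a s ha ih =>
    have := Th.mul (hf a (by simp)) (ih fun i hi => hf i (by simp [hi]))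
    simp only [Finset.prod_insert ha, Finset.card_insert_of_notMem ha]
    rwa [one_mul, show D + s.card * D = (s.card + 1) * D by ring] at this

/-! ### Laurent coefficients of theta functions, as Fourier coefficients on the unit circle. -/

/-- The parametrization of the unit circle by `ℝ / 2πℤ`. -/
def circ (x : AddCircle (2 * Real.pi)) : ℂˣ := Circle.toUnits (AddCircle.toCircle x)

instance : Fact (0 < 2 * Real.pi) := ⟨Real.two_pi_pos⟩

lemma val_circ (x : AddCircle (2 * Real.pi)) : (circ x : ℂ) = AddCircle.toCircle x := rfl

lemma circ_add (x y) : circ (x + y) = circ x * circ y := by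
  simp [circ, AddCircle.toCircle_add]

lemma circ_neg (x) : circ (-x) = (circ x)⁻¹ := by
  rw [circ, circ, AddCircle.toCircle_neg, map_inv]

lemma circ_coe (t : ℝ) : (circ (t : AddCircle (2 * Real.pi)) : ℂ) = exp (t * I) := by
  rw [val_circ, AddCircle.toCircle_apply_mk, Circle.coe_exp]
  congr 2
  have := Real.pi_ne_zero
  push_cast
  field_simp

lemma continuous_circ : Continuous circ := by
  rw [Units.continuous_iff]
  constructor
  · exact continuous_subtype_val.comp AddCircle.continuous_toCircle
  · have : (fun x => (((circ x)⁻¹ : ℂˣ) : ℂ)) = fun x => (circ (-x) : ℂ) := by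
      ext x; rw [circ_neg]
    rw [this]
    exact (continuous_subtype_val.comp AddCircle.continuous_toCircle).comp continuous_neg

/-- The Laurent coefficients of a function on `ℂ*`. -/
def laurentCoeff (f : ℂˣ → ℂ) (k : ℤ) : ℂ := fourierCoeff (fun x => f (circ x)) k

lemma laurentCoeff_eq (f : ℂˣ → ℂ) (k : ℤ) : laurentCoeff f k =
    ∫ x, f (circ x) * (circ x : ℂ) ^ (-k) ∂AddCircle.haarAddCircle := by
  simp only [laurentCoeff, fourierCoeff, fourier_apply, AddCircle.toCircle_zsmul, smul_eq_mul,
    val_circ, Circle.coe_zpow, mul_comm]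

lemma laurentCoeff_inv (f : ℂˣ → ℂ) (k : ℤ) :
    laurentCoeff (fun x => f x⁻¹) k = laurentCoeff f (-k) := by
  rw [laurentCoeff_eq, laurentCoeff_eq, ← integral_neg_eq_self]
  simp [circ_neg]

/-- Both means are contour integrals of F(z)/z, and Cauchy's theorem on the annulus between the two
circles identifies them. -/
lemma integral_circle_radius {F : ℂ → ℂ} (hF : DifferentiableOn ℂ F {0}ᶜ) {r : ℝ} (hr : 0 < r)
    (hr1 : r ≤ 1) : ∫ x, F (r * circ x) ∂AddCircle.haarAddCircle =
      ∫ x, F (circ x) ∂AddCircle.haarAddCircle := by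
  have key : ∀ ρ : ℝ, 0 < ρ → ∫ x, F (ρ * circ x) ∂AddCircle.haarAddCircle =
      (2 * Real.pi * I)⁻¹ * ∮ z in C(0, ρ), (z - 0)⁻¹ • F z := by
    intro ρ hρ
    have h := fourierCoeff_eq_intervalIntegral (T := 2 * Real.pi)
      (fun x => F (ρ * circ x)) 0 0
    simp only [fourierCoeff, neg_zero, fourier_zero, one_smul, zero_add] at h
    have h2 : ∮ z in C(0, ρ), (z - 0)⁻¹ • F z =
        I * ∫ t in (0 : ℝ)..2 * Real.pi, F (ρ * circ (t : AddCircle (2 * Real.pi))) := by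
      rw [circleIntegral, ← intervalIntegral.integral_const_mul]
      refine intervalIntegral.integral_congr fun t _ => ?_
      simp only [deriv_circleMap, circleMap, zero_add, sub_zero, smul_eq_mul, circ_coe]
      have h1 : (ρ : ℂ) ≠ 0 := by exact_mod_cast hρ.ne'
      have h2 := exp_ne_zero (t * I)
      field_simp
    rw [h, h2, Complex.real_smul]
    have := Real.pi_ne_zero
    have := I_ne_zero
    push_cast
    field_simp
  have h1 := key r hr
  have h2 := key 1 one_pos
  rw [ofReal_one] at h2
  simp only [one_mul] at h2
  rw [h1, h2, circleIntegral_sub_center_inv_smul_eq_of_differentiable_on_annulus_off_countable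
    hr hr1 Set.countable_empty]
  · refine hF.continuousOn.mono ?_
    rintro z ⟨_, hz⟩ rfl
    simp [hr] at hz
  · rintro z ⟨⟨_, hz⟩, _⟩
    refine hF.differentiableAt (isOpen_compl_singleton.mem_nhds ?_)
    rintro rfl
    simp [hr.le] at hz

/-- Multiplication by p is a change of radius followed by a rotation, and Haar measure does not see
the rotation. -/
lemma integral_comp_mul {p : ℂˣ} (hp : ‖(p : ℂ)‖ < 1) {f : ℂˣ → ℂ} (hf : IsHol f) :
    ∫ x, f (p * circ x) ∂AddCircle.haarAddCircle =
      ∫ x, f (circ x) ∂AddCircle.haarAddCircle := by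
  obtain ⟨F, hF, hF'⟩ := hf
  have hn : 0 < ‖(p : ℂ)‖ := by simp
  obtain ⟨a, ha⟩ : ∃ a : AddCircle (2 * Real.pi), (p : ℂ) = ‖(p : ℂ)‖ * circ a :=
    ⟨(arg (p : ℂ) : ℝ), by rw [circ_coe, norm_mul_exp_arg_mul_I]⟩
  have h := integral_circle_radius hF hn hp.le
  simp only [hF'] at h
  rw [← h, ← integral_add_left_eq_self (fun x => F (‖(p : ℂ)‖ * circ x)) a]
  congr 1
  ext x
  rw [circ_add, Units.val_mul (circ a), ← mul_assoc, ← ha, ← Units.val_mul, hF']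

lemma laurentCoeff_comp_mul {p : ℂˣ} (hp : ‖(p : ℂ)‖ < 1) {f : ℂˣ → ℂ} (hf : IsHol f) (k : ℤ) :
    laurentCoeff (fun x => f (p * x)) k = (p : ℂ) ^ k * laurentCoeff f k := by
  have hz : IsHol fun x => (x : ℂ) ^ (-k) :=
    ⟨fun z => z ^ (-k), fun z hz => (differentiableAt_zpow.2 (Or.inl hz)).differentiableWithinAt,
      fun _ => rfl⟩
  have h := integral_comp_mul hp (hf.mul hz)
  rw [laurentCoeff_eq, laurentCoeff_eq, ← h, ← integral_const_mul]
  congr 1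
  ext x
  have : (p : ℂ) ≠ 0 := p.ne_zero
  rw [Units.val_mul, mul_zpow, zpow_neg (p : ℂ)]
  field_simp

/-- Compare coefficients in the quasi-periodicity: the factor x^(-2D) shifts the index by 2D. -/
lemma Th.laurentCoeff_shift {p : ℂˣ} (hp : ‖(p : ℂ)‖ < 1) {ε : ℂ} {D : ℕ} {f : ℂˣ → ℂ}
    (hf : f ∈ Th p ε D) (k : ℤ) :
    laurentCoeff f (k + 2 * D) = (p : ℂ) ^ (k + D) * laurentCoeff f k := by
  obtain ⟨h0, -, h2⟩ := hf
  have h := laurentCoeff_comp_mul hp h0 k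
  rw [zpow_add₀ p.ne_zero, mul_right_comm, ← h, laurentCoeff_eq, laurentCoeff_eq,
    ← integral_mul_const]
  congr 1
  ext x
  have hp0 : (p : ℂ) ≠ 0 := p.ne_zero
  have hx0 : (circ x : ℂ) ≠ 0 := (circ x).ne_zero
  rw [h2, mul_zpow, ← zpow_natCast, ← zpow_mul, neg_add, zpow_add₀ hx0, zpow_neg (p : ℂ)]
  field_simp
  congr 1
  push_cast; ring_nf

lemma Th.laurentCoeff_neg {p : ℂˣ} {ε : ℂ} {D : ℕ} {f : ℂˣ → ℂ}
    (hf : f ∈ Th p ε D) (k : ℤ) : laurentCoeff f (-k) = ε * laurentCoeff f k := by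
  rw [← laurentCoeff_inv]
  simp only [hf.2.1]
  rw [laurentCoeff_eq, laurentCoeff_eq, ← integral_const_mul]
  simp only [mul_assoc]

lemma IsHol.eq_zero_of_laurentCoeff {f : ℂˣ → ℂ} (hf : IsHol f) (h : ∀ k, laurentCoeff f k = 0) :
    f = 0 := by
  have hc : Continuous fun x => f (circ x) := hf.continuous.comp continuous_circ
  have h1 : ∀ x, f (circ x) = 0 := by
    intro x
    have hs : Summable (fourierCoeff (⟨_, hc⟩ : C(AddCircle (2 * Real.pi), ℂ))) := by
      convert (summable_zero : Summable fun _ : ℤ => (0 : ℂ)) using 1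
      ext k
      exact h k
    have := has_pointwise_sum_fourier_series_of_summable hs x
    have h0 : fourierCoeff (⟨_, hc⟩ : C(AddCircle (2 * Real.pi), ℂ)) = 0 := by
      ext k; exact h k
    simp only [h0, Pi.zero_apply, zero_smul] at this
    exact (this.unique hasSum_zero)
  obtain ⟨F, hF, hF'⟩ := hf
  have hpre : IsPreconnected ({0}ᶜ : Set ℂ) :=
    (isConnected_compl_singleton_of_one_lt_rank (by simp) 0).isPreconnected
  -- The curve t ↦ exp(it) has nonzero velocity at 0, so its points accumulate at 1 without being
  -- equal to it; this feeds the identity theorem.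
  have hd : HasDerivAt (fun t : ℝ => exp (t * I)) I 0 := by
    have := ((hasDerivAt_id (0 : ℝ)).ofReal_comp.mul_const I).cexp
    simpa using this
  have ht := hd.tendsto_nhdsNE I_ne_zero
  simp only [ofReal_zero, zero_mul, exp_zero] at ht
  have hfr : ∃ᶠ z in 𝓝[≠] (1 : ℂ), F z = 0 := by
    refine ht.frequently (Eventually.frequently (Eventually.of_forall fun t => ?_))
    rw [← circ_coe, hF', h1]
  have := (hF.analyticOnNhd isOpen_compl_singleton).eqOn_zero_of_preconnected_of_frequently_eq_zero
    hpre (show (1 : ℂ) ∈ ({0}ᶜ : Set ℂ) by simp) hfr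
  ext x
  rw [← hF']
  exact this (by simp)

/-- The map sending a theta function to `r` consecutive Laurent coefficients. -/
def laurentMap (p : ℂˣ) (ε : ℂ) (D r : ℕ) (i₀ : ℕ) : Th p ε D →ₗ[ℂ] (Fin r → ℂ) where
  toFun f i := laurentCoeff f.1 (i₀ + i : ℕ)
  map_add' f g := by
    have hi (f : Th p ε D) : Integrable (fun x => f.1 (circ x)) AddCircle.haarAddCircle :=
      (f.2.1.continuous.comp continuous_circ).integrable_of_hasCompactSupport
        (HasCompactSupport.of_compactSpace _)
    ext i
    exact congrFun (fourierCoeff.add (hi f) (hi g)) _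
  map_smul' c f := by
    ext i
    exact fourierCoeff.const_smul (fun x => f.1 (circ x)) c _

/-- The indices from -D to D meet every class modulo 2D, and parity reduces the negative ones to the
positive ones. -/
lemma Th.laurentCoeff_zero_of_period {p : ℂˣ} (hp : ‖(p : ℂ)‖ < 1) {ε : ℂ} {D : ℕ} (hD : 0 < D)
    {f : ℂˣ → ℂ} (hf : f ∈ Th p ε D) (h : ∀ k : ℕ, k ≤ D → laurentCoeff f k = 0) (k : ℤ) :
    laurentCoeff f k = 0 := by
  have step : ∀ k : ℤ, laurentCoeff f (k + 2 * D) = 0 ↔ laurentCoeff f k = 0 := by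
    intro k
    rw [Th.laurentCoeff_shift hp hf]
    simp [zpow_ne_zero]
  have step' : ∀ (q k : ℤ), laurentCoeff f (k + 2 * D * q) = 0 ↔ laurentCoeff f k = 0 := by
    intro q
    induction q using Int.induction_on with
    | zero => simp
    | succ q ih =>
      intro k
      rw [← ih k, ← step (k + 2 * D * q)]
      ring_nf
    | pred q ih =>
      intro k
      rw [← ih k, ← step (k + 2 * D * _)]
      ring_nf
  have hsmall : ∀ k : ℤ, |k| ≤ D → laurentCoeff f k = 0 := by
    intro k hk
    obtain ⟨j, rfl | rfl⟩ := k.eq_nat_or_neg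
    · exact h j (by simpa using hk)
    · rw [Th.laurentCoeff_neg hf, h j (by simpa using hk), mul_zero]
  have hD' : (0 : ℤ) < 2 * D := by positivity
  have h1 := Int.emod_add_mul_ediv (k + D) (2 * D)
  have h2 := Int.emod_nonneg (k + D) hD'.ne'
  have h3 := Int.emod_lt_of_pos (k + D) hD'
  have : k = ((k + D) % (2 * D) - D) + 2 * D * ((k + D) / (2 * D)) := by linarith
  rw [this, step']
  exact hsmall _ (abs_le.2 ⟨by linarith, by linarith⟩)

lemma injective_laurentMap_even {p : ℂˣ} (hp : ‖(p : ℂ)‖ < 1) (D : ℕ) :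
    Injective (laurentMap p 1 D (D + 1) 0) := by
  rw [← LinearMap.ker_eq_bot, LinearMap.ker_eq_bot']
  intro f hf
  have h0 : ∀ k : ℕ, k ≤ D → laurentCoeff f.1 k = 0 := by
    intro k hk
    simpa [laurentMap] using congrFun hf ⟨k, by omega⟩
  refine Subtype.ext (f.2.1.eq_zero_of_laurentCoeff fun k => ?_)
  rcases Nat.eq_zero_or_pos D with rfl | hD
  -- For D = 0 the recursion does not move the index. It says (1 - p^k) c_k = 0, and p^k ≠ 1 for k ≠
  -- 0 because 0 < |p| < 1.
  · by_cases hk : k = 0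
    · subst hk; exact h0 0 le_rfl
    have h := Th.laurentCoeff_shift hp f.2 k
    simp only [Nat.cast_zero, mul_zero, add_zero] at h
    have h1 : (1 - (p : ℂ) ^ k) * laurentCoeff f.1 k = 0 := by linear_combination h
    refine (mul_eq_zero.1 h1).resolve_left fun h2 => hk ?_
    have h3 : ‖(p : ℂ)‖ ^ k = 1 := by
      rw [← norm_zpow, ← sub_eq_zero.1 h2, norm_one]
    rcases (zpow_eq_one_iff_of_ne_zero₀ hk).1 h3 with h4 | h4
    · exact absurd h4 hp.ne
    · exact absurd (h4.1) (by linarith [norm_nonneg (p : ℂ)])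
  · exact Th.laurentCoeff_zero_of_period hp hD f.2 h0 k

/-- Of the coefficients with index 0, …, D + 2 the two extreme ones vanish automatically: index 0 by
oddness, and index D + 2 because the shift from -(D + 2) has factor 1 while oddness changes the
sign. This leaves D + 1 coefficients. -/
lemma injective_laurentMap_odd {p : ℂˣ} (hp : ‖(p : ℂ)‖ < 1) (D : ℕ) :
    Injective (laurentMap p (-1) (D + 2) (D + 1) 1) := by
  rw [← LinearMap.ker_eq_bot, LinearMap.ker_eq_bot']
  intro f hf
  refine Subtype.ext (f.2.1.eq_zero_of_laurentCoeff fun k => ?_)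
  refine Th.laurentCoeff_zero_of_period hp (by omega) f.2 (fun k hk => ?_) k
  rcases Nat.eq_zero_or_pos k with rfl | hk0
  · have := Th.laurentCoeff_neg f.2 0
    simp only [neg_zero] at this
    have h2 : 2 * laurentCoeff f.1 0 = 0 := by linear_combination this
    simpa using h2
  rcases eq_or_lt_of_le hk with rfl | hk
  · have h1 := Th.laurentCoeff_neg f.2 ((D + 2 : ℕ) : ℤ)
    have h2 := Th.laurentCoeff_shift hp f.2 (-((D + 2 : ℕ) : ℤ))
    rw [neg_add_cancel, zpow_zero, one_mul, h1] at h2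
    have h3 : -((D + 2 : ℕ) : ℤ) + 2 * ((D + 2 : ℕ) : ℤ) = ((D + 2 : ℕ) : ℤ) := by ring
    rw [h3] at h2
    have h4 : 2 * laurentCoeff f.1 ((D + 2 : ℕ) : ℤ) = 0 := by linear_combination h2
    simpa using h4
  · have := congrFun hf ⟨k - 1, by omega⟩
    simp only [laurentMap, LinearMap.coe_mk, AddHom.coe_mk, Pi.zero_apply] at this
    rwa [show 1 + (k - 1) = k by omega] at this

/-- A space of functions of dimension at most `r` which contains functions dual to the evaluations
at `r` points is separated by these points. -/
lemma eq_zero_of_dual {X : Type*} {V : Submodule ℂ (X → ℂ)} {r : ℕ} {L : V →ₗ[ℂ] (Fin r → ℂ)}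
    (hL : Injective L) (x : Fin r → X) (l : Fin r → X → ℂ) (hl : ∀ k, l k ∈ V)
    (hl0 : ∀ j k, j ≠ k → l k (x j) = 0) (hl1 : ∀ k, l k (x k) ≠ 0) {f : X → ℂ} (hf : f ∈ V)
    (h : ∀ k, f (x k) = 0) : f = 0 := by
  let ev : V →ₗ[ℂ] (Fin r → ℂ) :=
    { toFun := fun f k => f.1 (x k), map_add' := fun _ _ => rfl, map_smul' := fun _ _ => rfl }
  have : FiniteDimensional ℂ V := FiniteDimensional.of_injective L hL
  have hsurj : Surjective ev := by
    intro v
    refine ⟨∑ k, (v k / l k (x k)) • ⟨l k, hl k⟩, ?_⟩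
    ext j
    rw [map_sum, Finset.sum_apply, Finset.sum_eq_single j]
    · simp [ev, hl1]
    · intro k _ hk
      simp [ev, hl0 j k hk.symm]
    · simp
  have h1 := LinearMap.finrank_le_finrank_of_injective hL
  have h2 := LinearMap.finrank_le_finrank_of_surjective hsurj
  have hinj := (LinearMap.injective_iff_surjective_of_finrank_eq_finrank (le_antisymm h1 h2)).2 hsurj
  have h3 : (⟨f, hf⟩ : V) = 0 := hinj (by ext k; simpa [ev] using h k)
  exact congrArg Subtype.val h3

/-! ### Lagrange interpolation in one variable. -/

section Lagrange

variable {p : ℂˣ} (hp : ‖(p : ℂ)‖ < 1)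
include hp

lemma e_mem_Th (v : ℂˣ) : (fun u => e p u v) ∈ Th p 1 1 :=
  ⟨isHol_e hp v, fun x => by simp [e_inv_left hp], fun x => by simp [e_p_mul hp]⟩

lemma e_mem_Th' (u : ℂˣ) : (fun v => e p u v) ∈ Th p 1 1 := by
  have := (Th p 1 1).smul_mem (-1) (e_mem_Th hp u)
  convert this using 1
  ext v
  rw [e_swap hp]; simp

/-- The odd theta function `x⁻¹ θ(x²)`. -/
def oddTheta (p x : ℂˣ) : ℂ := (x : ℂ)⁻¹ * theta p (x ^ 2)

lemma oddTheta_inv (x : ℂˣ) : oddTheta p x⁻¹ = -oddTheta p x := by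
  rw [oddTheta, oddTheta, inv_pow, theta_inv hp]
  have := x.ne_zero
  push_cast
  field_simp

lemma oddTheta_mem_Th : oddTheta p ∈ Th p (-1) 2 := by
  refine ⟨?_, fun x => by rw [oddTheta_inv hp, neg_one_mul], fun x => ?_⟩
  · have := (isHol_inv_pow 1).mul (isHol_theta hp).comp_sq
    simp only [pow_one] at this
    exact this
  · have h : (p * x) ^ 2 = p * (p * x ^ 2) := by rw [mul_pow, sq p, mul_assoc]
    rw [oddTheta, oddTheta, h, theta_p_mul hp, theta_p_mul hp]
    have := x.ne_zero; have := p.ne_zero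
    push_cast
    simp only [zpow_neg]
    norm_cast
    push_cast
    field_simp

/-- Lagrange interpolation functions. -/
def lagrange (p : ℂˣ) {D : ℕ} (x : Fin (D + 1) → ℂˣ) (k : Fin (D + 1)) (z : ℂˣ) : ℂ :=
  ∏ j ∈ Finset.univ.erase k, e p z (x j) / e p (x k) (x j)

lemma lagrange_mem_Th {D : ℕ} (x : Fin (D + 1) → ℂˣ) (k : Fin (D + 1)) :
    lagrange p x k ∈ Th p 1 D := by
  have h := Th.prod (p := p) (D := 1) (Finset.univ.erase k)
    (f := fun j z => e p z (x j) / e p (x k) (x j)) (fun j _ => by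
      have := (Th p 1 1).smul_mem (e p (x k) (x j))⁻¹ (e_mem_Th hp (x j))
      convert this using 1
      ext z
      simp [div_eq_inv_mul])
  rwa [Finset.card_erase_of_mem (Finset.mem_univ k), Finset.card_univ, Fintype.card_fin,
    add_tsub_cancel_right, mul_one] at h

omit hp in
lemma lagrange_self {D : ℕ} {x : Fin (D + 1) → ℂˣ} (hx : ∀ i j, i ≠ j → e p (x i) (x j) ≠ 0)
    (k : Fin (D + 1)) : lagrange p x k (x k) = 1 :=
  Finset.prod_eq_one fun _ hj => div_self (hx _ _ (Finset.ne_of_mem_erase hj).symm)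

omit hp in
lemma lagrange_of_ne {D : ℕ} (x : Fin (D + 1) → ℂˣ) {j k : Fin (D + 1)} (hjk : j ≠ k) :
    lagrange p x k (x j) = 0 :=
  Finset.prod_eq_zero (i := j) (by simp [hjk]) (by simp [e_self])

lemma Th.eq_zero_even {D : ℕ} {x : Fin (D + 1) → ℂˣ} (hx : ∀ i j, i ≠ j → e p (x i) (x j) ≠ 0)
    {f : ℂˣ → ℂ} (hf : f ∈ Th p 1 D) (h : ∀ k, f (x k) = 0) : f = 0 :=
  eq_zero_of_dual (injective_laurentMap_even hp D) x (lagrange p x) (lagrange_mem_Th hp x)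
    (fun _ _ hjk => lagrange_of_ne x hjk) (fun k => by simp [lagrange_self hx]) hf h

/-- The even Lagrange functions times `oddTheta`, which has degree 2, are dual to evaluation at the
nodes up to nonzero factors, and their number equals the dimension bound. -/
lemma Th.eq_zero_odd {D : ℕ} {x : Fin (D + 1) → ℂˣ} (hx : ∀ i j, i ≠ j → e p (x i) (x j) ≠ 0)
    (hx' : ∀ i, theta p (x i ^ 2) ≠ 0)
    {f : ℂˣ → ℂ} (hf : f ∈ Th p (-1) (D + 2)) (h : ∀ k, f (x k) = 0) : f = 0 :=
  eq_zero_of_dual (injective_laurentMap_odd hp D) x (fun k z => lagrange p x k z * oddTheta p z)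
    (fun k => by simpa using Th.mul (lagrange_mem_Th hp x k) (oddTheta_mem_Th hp))
    (fun _ _ hjk => by simp [lagrange_of_ne x hjk])
    (fun k => by simp [lagrange_self hx, oddTheta, hx']) hf h

end Lagrange


/-! ### Symmetric functions and multisets of coordinates -/

/-- The multiset of coordinates of a tuple. -/
def mset {α : Type*} {N : ℕ} (z : Fin N → α) : Multiset α := ∑ i, {z i}

lemma mset_cons {α : Type*} {N : ℕ} (c : α) (z : Fin N → α) :
    mset (Fin.cons c z : Fin (N + 1) → α) = {c} + mset z := by
  simp [mset, Fin.sum_univ_succ]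

lemma mset_removeNth {α : Type*} {N : ℕ} (i : Fin (N + 1)) (z : Fin (N + 1) → α) :
    {z i} + mset (i.removeNth z) = mset z := by
  simp [mset, Fin.sum_univ_succAbove _ i, Fin.removeNth]

lemma exists_perm_of_mset_eq {α : Type*} {N : ℕ} {z w : Fin N → α} (h : mset z = mset w) :
    ∃ σ : Equiv.Perm (Fin N), z = w ∘ σ := by
  classical
  have hcount : ∀ c, Fintype.card {i // z i = c} = Fintype.card {i // w i = c} := by
    intro c
    have hz : ∀ z : Fin N → α, Multiset.count c (mset z) = Fintype.card {i // z i = c} := by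
      intro z
      rw [mset, Multiset.count_sum', Fintype.card_subtype, Finset.card_filter]
      simp only [Multiset.count_singleton, eq_comm]
    rw [← hz, ← hz, h]
  let e := fun c => Fintype.equivOfCardEq (hcount c)
  exact ⟨Equiv.ofFiberEquiv e, by ext i; exact (Equiv.ofFiberEquiv_map e i).symm⟩

/-- Invariance under permutations of the coordinates. -/
def IsSym {α : Type*} {N : ℕ} (f : (Fin N → α) → ℂ) : Prop :=
  ∀ (σ : Equiv.Perm (Fin N)) (z : Fin N → α), f (fun i => z (σ i)) = f z

lemma IsSym.eq_of_mset_eq {α : Type*} {N : ℕ} {f : (Fin N → α) → ℂ} (hf : IsSym f)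
    {z w : Fin N → α} (h : mset z = mset w) : f z = f w := by
  obtain ⟨σ, rfl⟩ := exists_perm_of_mset_eq h
  exact hf σ w

/-- The positions in a reference point are indexed by the pairs of a string and an exponent. -/
def Z.equiv {s n : ℕ} (ν : Z s n) : Fin n ≃ Σ k, Fin (ν.1 k) :=
  (finCongr ν.2.symm).trans finSigmaFinEquiv.symm

lemma refPoint_apply {s n : ℕ} (t : ℂˣ) (c : Fin s → ℂˣ) (ν : Z s n) (i : Fin n) :
    refPoint t c ν i = t ^ ((ν.equiv i).2 : ℕ) * c (ν.equiv i).1 := rfl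

lemma mset_refPoint {s n : ℕ} (t : ℂˣ) (c : Fin s → ℂˣ) (μ : Z s n) :
    mset (refPoint t c μ) = ∑ k, ∑ j ∈ Finset.range (μ.1 k), {t ^ j * c k} := by
  refine (μ.equiv.sum_comp (fun x : Σ k, Fin (μ.1 k) =>
    ({t ^ (x.2 : ℕ) * c x.1} : Multiset ℂˣ))).trans ?_
  simp only [Fintype.sum_sigma, Finset.sum_range]

/-! ### Functions that are theta functions in each variable -/

/-- Functions of `N` variables that belong to `Th p ε D` in each variable. -/
def SepTh (p : ℂˣ) (ε : ℂ) (D N : ℕ) : Submodule ℂ ((Fin N → ℂˣ) → ℂ) where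
  carrier := {f | ∀ i z, (fun x => f (update z i x)) ∈ Th p ε D}
  add_mem' hf hg i z := (Th p ε D).add_mem (hf i z) (hg i z)
  zero_mem' _ _ := (Th p ε D).zero_mem
  smul_mem' c _ hf i z := (Th p ε D).smul_mem c (hf i z)

lemma SepTh.mul {p : ℂˣ} {ε ε' : ℂ} {D D' N : ℕ} {f g : (Fin N → ℂˣ) → ℂ}
    (hf : f ∈ SepTh p ε D N) (hg : g ∈ SepTh p ε' D' N) :
    (fun x => f x * g x) ∈ SepTh p (ε * ε') (D + D') N :=
  fun i z => Th.mul (hf i z) (hg i z)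

lemma SepTh.prod_apply {p : ℂˣ} {ε : ℂ} {D N : ℕ} {h : Fin N → ℂˣ → ℂ}
    (hh : ∀ i, h i ∈ Th p ε D) : (fun z => ∏ i, h i (z i)) ∈ SepTh p ε D N := by
  intro i z
  have := (Th p ε D).smul_mem (∏ j ∈ Finset.univ.erase i, h j (z j)) (hh i)
  convert this using 1
  ext x
  dsimp only
  rw [← Finset.mul_prod_erase _ _ (Finset.mem_univ i), Pi.smul_apply, smul_eq_mul, mul_comm]
  congr 1
  · exact Finset.prod_congr rfl fun j hj => by rw [update_of_ne (Finset.ne_of_mem_erase hj)]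
  · rw [update_self]

lemma SepTh.cons {p : ℂˣ} {ε : ℂ} {D n : ℕ} {A : ℂˣ → (Fin n → ℂˣ) → ℂ}
    (h0 : ∀ w, (fun x => A x w) ∈ Th p ε D) (h1 : ∀ x, A x ∈ SepTh p ε D n) :
    (fun z : Fin (n + 1) → ℂˣ => A (z 0) (Fin.tail z)) ∈ SepTh p ε D (n + 1) := by
  intro i z
  refine Fin.cases ?_ (fun i => ?_) i
  · simpa using h0 (Fin.tail z)
  · have : ∀ x, update z i.succ x 0 = z 0 := fun x => update_of_ne (Fin.succ_ne_zero i).symm _ _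
    simpa [this] using h1 (z 0) i (Fin.tail z)

lemma SepTh.comp_perm {p : ℂˣ} {ε : ℂ} {D N : ℕ} {f : (Fin N → ℂˣ) → ℂ} (hf : f ∈ SepTh p ε D N)
    (σ : Equiv.Perm (Fin N)) : (fun z : Fin N → ℂˣ => f (fun i => z (σ i))) ∈ SepTh p ε D N := by
  intro i z
  convert hf (σ.symm i) (fun i => z (σ i)) using 1
  ext x
  dsimp only
  congr 1
  funext j
  simp only [update_apply, Equiv.eq_symm_apply]

/-- A function of several variables vanishes if it vanishes on a grid and its restrictions to the
coordinate lines are determined by their values on the grid. -/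
lemma eq_zero_of_grid {X ι : Type*} {N : ℕ} (x : ι → X) {f : (Fin N → X) → ℂ}
    (hline : ∀ i z, (∀ k, f (update z i (x k)) = 0) → ∀ y, f (update z i y) = 0)
    (h : ∀ κ : Fin N → ι, f (x ∘ κ) = 0) (z : Fin N → X) : f z = 0 := by
  classical
  -- The set A holds the coordinates that have been freed from the grid; they are freed one at a
  -- time.
  suffices H : ∀ (A : Finset (Fin N)) (z : Fin N → X), (∀ i ∉ A, ∃ k, z i = x k) → f z = 0 from
    H Finset.univ z (by simp)
  intro A
  induction A using Finset.induction_on with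
  | empty =>
    intro z hz
    choose κ hκ using fun i => hz i (by simp)
    rw [show z = x ∘ κ from funext hκ]
    exact h κ
  | insert a A ha ih =>
    intro z hz
    rw [← update_eq_self a z]
    refine hline a z (fun k => ih _ fun i hi => ?_) (z a)
    rcases eq_or_ne i a with rfl | hia
    · exact ⟨k, by simp⟩
    · rw [update_of_ne hia]
      exact hz i (by simp [hia, hi])

/-! ### Uniqueness on grids, and grids in generic position. -/

section Grid

variable {p : ℂˣ} (hp : ‖(p : ℂ)‖ < 1)
include hp

lemma SepTh.eq_zero_even {D N : ℕ} {x : Fin (D + 1) → ℂˣ}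
    (hx : ∀ i j, i ≠ j → e p (x i) (x j) ≠ 0) {f : (Fin N → ℂˣ) → ℂ} (hf : f ∈ SepTh p 1 D N)
    (h : ∀ κ : Fin N → Fin (D + 1), f (x ∘ κ) = 0) (z : Fin N → ℂˣ) : f z = 0 :=
  eq_zero_of_grid x (fun i z h => congrFun (Th.eq_zero_even hp hx (hf i z) h)) h z

lemma SepTh.eq_zero_odd {D N : ℕ} {x : Fin (D + 1) → ℂˣ}
    (hx : ∀ i j, i ≠ j → e p (x i) (x j) ≠ 0) (hx' : ∀ i, theta p (x i ^ 2) ≠ 0)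
    {f : (Fin N → ℂˣ) → ℂ} (hf : f ∈ SepTh p (-1) (D + 2) N)
    (h : ∀ κ : Fin N → Fin (D + 1), f (x ∘ κ) = 0) (z : Fin N → ℂˣ) : f z = 0 :=
  eq_zero_of_grid x (fun i z h => congrFun (Th.eq_zero_odd hp hx hx' (hf i z) h)) h z

lemma SepTh.eq_even {D N : ℕ} {x : Fin (D + 1) → ℂˣ}
    (hx : ∀ i j, i ≠ j → e p (x i) (x j) ≠ 0) {f g : (Fin N → ℂˣ) → ℂ} (hf : f ∈ SepTh p 1 D N)
    (hg : g ∈ SepTh p 1 D N)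
    (h : ∀ κ : Fin N → Fin (D + 1), f (x ∘ κ) = g (x ∘ κ)) : f = g := by
  ext z
  have := SepTh.eq_zero_even hp hx ((SepTh p 1 D N).sub_mem hf hg) (fun κ => by simp [h κ]) z
  simpa [sub_eq_zero] using this

lemma SepTh.eq_odd {D N : ℕ} {x : Fin (D + 1) → ℂˣ}
    (hx : ∀ i j, i ≠ j → e p (x i) (x j) ≠ 0) (hx' : ∀ i, theta p (x i ^ 2) ≠ 0)
    {f g : (Fin N → ℂˣ) → ℂ} (hf : f ∈ SepTh p (-1) (D + 2) N) (hg : g ∈ SepTh p (-1) (D + 2) N)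
    (h : ∀ κ : Fin N → Fin (D + 1), f (x ∘ κ) = g (x ∘ κ)) : f = g := by
  ext z
  have := SepTh.eq_zero_odd hp hx hx' ((SepTh p (-1) (D + 2) N).sub_mem hf hg)
    (fun κ => by simp [h κ]) z
  simpa [sub_eq_zero] using this

/-- Every finite set of points can be avoided by a generic point. -/
lemma exists_generic (h0 : ∃ u, theta p u ≠ 0) (S : Finset ℂˣ) :
    ∃ y : ℂˣ, theta p (y ^ 2) ≠ 0 ∧ ∀ x ∈ S, e p x y ≠ 0 := by
  obtain ⟨u, hu⟩ := h0
  -- A square root of u witnesses that y ↦ θ(y²) is not identically zero.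
  obtain ⟨v, hv⟩ := IsAlgClosed.exists_pow_nat_eq (u : ℂ) two_pos
  have hv0 : v ≠ 0 := by rintro rfl; simp [eq_comm] at hv
  let f : Fin 3 × ℂˣ → ℂˣ → ℂ := fun i y =>
    match i with
    | (0, _) => theta p (y ^ 2)
    | (1, x) => theta p (y * x)
    | (2, x) => theta p (y * x⁻¹)
  -- Inserting 1 keeps the index set nonempty, so that the condition on θ(y²) is present even when S
  -- is empty.
  have hd := dense_forall_ne_zero (Finset.univ ×ˢ insert 1 S) (f := f)
    (by
      rintro ⟨i, x⟩ -
      fin_cases i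
      · exact (isHol_theta hp).comp_sq
      · exact (isHol_theta hp).comp_mul_right x
      · exact (isHol_theta hp).comp_mul_right x⁻¹)
    (by
      rintro ⟨i, x⟩ -
      fin_cases i
      · refine ⟨Units.mk0 v hv0, ?_⟩
        have : (Units.mk0 v hv0) ^ 2 = u := Units.ext (by simp [hv])
        simpa [f, this] using hu
      · exact ⟨u * x⁻¹, by simpa [f] using hu⟩
      · exact ⟨u * x, by simpa [f] using hu⟩)
  obtain ⟨y, hy⟩ := hd.nonempty
  refine ⟨y, hy (0, 1) (by simp), fun x hx => ?_⟩
  rw [e_swap hp, neg_ne_zero, e_ne_zero_iff]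
  exact ⟨hy (1, x) (by simp [hx]), hy (2, x) (by simp [hx])⟩

lemma exists_generic_seq (h0 : ∃ u, theta p u ≠ 0) (S : Finset ℂˣ) :
    ∃ x : ℕ → ℂˣ, (∀ n, theta p (x n ^ 2) ≠ 0) ∧ (∀ n, ∀ c ∈ S, e p c (x n) ≠ 0) ∧
      ∀ i j, i ≠ j → e p (x i) (x j) ≠ 0 := by
  classical
  obtain ⟨x, hx, hx'⟩ := exists_seq_of_forall_finset_exists
    (fun y => theta p (y ^ 2) ≠ 0 ∧ ∀ c ∈ S, e p c y ≠ 0) (fun x y => e p x y ≠ 0)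
    (fun T _ => by
      obtain ⟨y, hy, hy'⟩ := exists_generic hp h0 (S ∪ T)
      exact ⟨y, ⟨hy, fun c hc => hy' c (by simp [hc])⟩, fun c hc => hy' c (by simp [hc])⟩)
  refine ⟨x, fun n => (hx n).1, fun n => (hx n).2, fun i j hij => ?_⟩
  rcases lt_or_gt_of_ne hij with h | h
  · exact hx' i j h
  · rw [e_swap hp, neg_ne_zero]
    exact hx' j i h

/-! ### Characterization of `H p d N` -/

omit hp in
lemma IsHolomorphic.prod_apply {N : ℕ} {h : Fin N → ℂˣ → ℂ} (hh : ∀ i, IsHol (h i)) :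
    IsHolomorphic fun z : Fin N → ℂˣ => ∏ i, h i (z i) := by
  choose F hF hF' using hh
  refine ⟨fun z => ∏ i, F i (z i), ?_, fun z => by simp [hF']⟩
  have h1 : ∀ i, DifferentiableOn ℂ (fun z : Fin N → ℂ => F i (z i)) {z | ∀ i, z i ≠ 0} :=
    fun i => (hF i).comp (by fun_prop) fun z hz => hz i
  classical
  have h2 : ∀ s : Finset (Fin N), DifferentiableOn ℂ (fun z : Fin N → ℂ => ∏ i ∈ s, F i (z i))
      {z | ∀ i, z i ≠ 0} := by
    intro s
    induction s using Finset.induction_on with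
    | empty => simp
    | insert a s ha ih =>
      simp only [Finset.prod_insert ha]
      exact (h1 a).mul ih
  exact h2 _

omit hp in
lemma IsHolomorphic.sum {N : ℕ} {ι : Type*} (s : Finset ι) {f : ι → (Fin N → ℂˣ) → ℂ} (c : ι → ℂ)
    (hf : ∀ i, IsHolomorphic (f i)) : IsHolomorphic fun z => ∑ i ∈ s, c i * f i z := by
  choose F hF hF' using hf
  exact ⟨fun z => ∑ i ∈ s, c i * F i z, DifferentiableOn.fun_sum fun i _ => (hF i).const_mul _,
    fun z => by simp [hF']⟩

omit hp in
lemma IsHolomorphic.isHol_update {N : ℕ} {f : (Fin N → ℂˣ) → ℂ} (hf : IsHolomorphic f) (i : Fin N)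
    (z : Fin N → ℂˣ) : IsHol fun x => f (update z i x) := by
  obtain ⟨F, hF, hF'⟩ := hf
  refine ⟨fun x => F (update (fun j => (z j : ℂ)) i x), hF.comp (fun x _ => ?_) ?_, fun x => ?_⟩
  · exact (hasFDerivAt_update (𝕜 := ℂ) (E := fun _ => ℂ) _ x).differentiableAt.differentiableWithinAt
  · intro x hx j
    rcases eq_or_ne j i with rfl | hj
    · simpa using hx
    · simp [hj]
  · dsimp only
    rw [← hF']
    congr 1
    ext j
    rcases eq_or_ne j i with rfl | hj
    · simp
    · simp [hj]

omit hp in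
lemma IsHolomorphic.continuous {N : ℕ} {f : (Fin N → ℂˣ) → ℂ} (hf : IsHolomorphic f) :
    Continuous f := by
  obtain ⟨F, hF, hF'⟩ := hf
  have : f = fun z => F (fun i => (z i : ℂ)) := by ext z; rw [hF']
  rw [this]
  refine hF.continuousOn.comp_continuous ?_ fun x i => by simp
  exact continuous_pi fun i => Units.continuous_val.comp (continuous_apply i)

omit hp in
lemma sepTh_of_mem_H {d N : ℕ} {f : (Fin N → ℂˣ) → ℂ} (hf : f ∈ H p d N) : f ∈ SepTh p 1 d N := by
  obtain ⟨h0, -, h2, h3⟩ := hf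
  intro i z
  refine ⟨h0.isHol_update i z, fun x => ?_, fun x => ?_⟩
  · simpa using h2 i (update z i x)
  · simpa using h3 i (update z i x)

/-- Interpolation of symmetric data on a grid. -/
lemma exists_grid_interpolation {d N : ℕ} {x : Fin (d + 1) → ℂˣ}
    (hx : ∀ i j, i ≠ j → e p (x i) (x j) ≠ 0) {v : (Fin N → Fin (d + 1)) → ℂ} (hv : IsSym v) :
    ∃ g ∈ H p d N, ∀ κ, g (x ∘ κ) = v κ := by
  classical
  let g : (Fin N → ℂˣ) → ℂ := fun z => ∑ κ, v κ * ∏ i, lagrange p x (κ i) (z i)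
  have hg : g ∈ SepTh p 1 d N := by
    have : g = ∑ κ, v κ • fun z : Fin N → ℂˣ => ∏ i, lagrange p x (κ i) (z i) := by
      ext z; simp [g]
    rw [this]
    exact Submodule.sum_mem _ fun κ _ => Submodule.smul_mem _ _
      (SepTh.prod_apply fun i => lagrange_mem_Th hp x (κ i))
  refine ⟨g, ⟨?_, fun σ z => ?_, fun i z => ?_, fun i z => ?_⟩, fun κ => ?_⟩
  · exact IsHolomorphic.sum _ _ fun κ =>
      IsHolomorphic.prod_apply fun i => (lagrange_mem_Th hp x (κ i)).1
  · refine Fintype.sum_equiv (σ.arrowCongr (Equiv.refl _)) _ _ fun κ => ?_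
    congr 1
    · have := hv σ.symm κ
      exact this.symm
    · rw [← Equiv.prod_comp σ (fun i => lagrange p x ((σ.arrowCongr (Equiv.refl _)) κ i) (z i))]
      simp [Equiv.arrowCongr]
  · have := (hg i z).2.1 (z i)
    simpa using this
  · have := (hg i z).2.2 (z i)
    simpa using this
  · simp only [g]
    rw [Finset.sum_eq_single κ]
    · simp [lagrange_self hx]
    · intro κ' _ hκ
      obtain ⟨i, hi⟩ := Function.ne_iff.1 hκ
      rw [Finset.prod_eq_zero (Finset.mem_univ i) (lagrange_of_ne x (Ne.symm hi)), mul_zero]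
    · simp

/-- Joint holomorphy comes for free: a separately theta function equals its Lagrange interpolant on
a generic grid, a finite sum of products of one-variable functions. -/
lemma mem_H_iff (h0 : ∃ u, theta p u ≠ 0) {d N : ℕ} {f : (Fin N → ℂˣ) → ℂ} :
    f ∈ H p d N ↔ IsSym f ∧ f ∈ SepTh p 1 d N := by
  refine ⟨fun h => ⟨h.2.1, sepTh_of_mem_H h⟩, fun ⟨h1, h2⟩ => ?_⟩
  obtain ⟨x, -, -, hx⟩ := exists_generic_seq hp h0 ∅
  have hx' : ∀ i j : Fin (d + 1), i ≠ j → e p (x i) (x j) ≠ 0 := fun i j hij =>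
    hx i j (by simpa [Fin.ext_iff] using hij)
  obtain ⟨g, hg, hgv⟩ := exists_grid_interpolation hp (x := fun i => x i) hx'
    (v := fun κ : Fin N → Fin (d + 1) => f fun i => x (κ i)) (fun σ κ => h1 σ fun i => x (κ i))
  rwa [SepTh.eq_even hp hx' h2 (sepTh_of_mem_H hg) fun κ => (hgv κ).symm]

end Grid


/-! ### Multi-indices -/

/-- The constructor of `Z s n`. -/
def Z.of {s n : ℕ} (μ : Fin s → ℕ) (h : ∑ k, μ k = n) : Z s n := ⟨μ, h⟩

@[simp] lemma Z.of_val {s n : ℕ} (μ : Fin s → ℕ) (h : ∑ k, μ k = n) : (Z.of μ h).1 = μ := rfl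

/-- Multi-indices as elements of the symmetric power. -/
def Z.symEquiv (s n : ℕ) : Sym (Fin s) n ≃ Z s n := Sym.equivNatSumOfFintype (Fin s) n

instance (s n : ℕ) : Fintype (Z s n) := Fintype.ofEquiv _ (Z.symEquiv s n)

lemma card_Z (s n : ℕ) : Fintype.card (Z s n) = s.multichoose n := by
  rw [← Fintype.card_congr (Z.symEquiv s n), Sym.card_sym_eq_multichoose, Fintype.card_fin]

lemma Z.le {s n : ℕ} (ν : Z s n) (k : Fin s) : ν.1 k ≤ n := by
  exact (Finset.single_le_sum (f := ν.1) (fun _ _ => Nat.zero_le _) (Finset.mem_univ k)).trans_eq ν.2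

lemma Z.add_le {s n : ℕ} (ν : Z s n) {k l : Fin s} (h : k ≠ l) : ν.1 k + ν.1 l ≤ n := by
  rw [← Finset.sum_pair (f := ν.1) h]
  exact (Finset.sum_le_sum_of_subset (Finset.subset_univ _)).trans_eq ν.2

/-- The multi-index `ν + ε_k`. -/
def Z.inc {s n : ℕ} (ν : Z s n) (k : Fin s) : Z s (n + 1) :=
  ⟨ν.1 + Pi.single k 1, by simp [Finset.sum_add_distrib, ν.2]⟩

lemma Z.inc_self {s n : ℕ} (ν : Z s n) (k : Fin s) : (ν.inc k).1 k = ν.1 k + 1 := by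
  simp [Z.inc]

lemma Z.inc_of_ne {s n : ℕ} (ν : Z s n) {k l : Fin s} (h : l ≠ k) : (ν.inc k).1 l = ν.1 l := by
  simp [Z.inc, h]

lemma Z.exists_inc {s n : ℕ} (ν : Z s (n + 1)) {k : Fin s} (h : 0 < ν.1 k) :
    ∃ μ : Z s n, μ.inc k = ν := by
  have h1 : (fun l => ν.1 l - (Pi.single k 1 : Fin s → ℕ) l) + Pi.single k 1 = ν.1 := by
    ext l
    rcases eq_or_ne l k with rfl | hl
    · simp; omega
    · simp [hl]
  have h2 : ∑ l, (ν.1 l - (Pi.single k 1 : Fin s → ℕ) l) = n := by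
    have h3 := congrArg (fun f : Fin s → ℕ => ∑ l, f l) h1
    simp only [Pi.add_apply, Finset.sum_add_distrib, ν.2, Finset.sum_pi_single', Finset.mem_univ,
      if_true] at h3
    simpa using h3
  exact ⟨⟨_, h2⟩, Subtype.ext h1⟩

lemma mset_refPoint_inc {s n : ℕ} (t : ℂˣ) (c : Fin s → ℂˣ) (ν : Z s n) (k : Fin s) :
    mset (refPoint t c (ν.inc k)) = {t ^ ν.1 k * c k} + mset (refPoint t c ν) := by
  rw [mset_refPoint, mset_refPoint, ← Finset.add_sum_erase _ _ (Finset.mem_univ k),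
    ← Finset.add_sum_erase _ _ (Finset.mem_univ k), Z.inc_self, Finset.sum_range_succ, add_comm _ {_},
    add_assoc]
  congr 2
  exact Finset.sum_congr rfl fun l hl => by rw [Z.inc_of_ne ν (Finset.ne_of_mem_erase hl)]

/-- Here the first point of string k is split off rather than the last, and what remains is a string
starting at t c_k. This drives the induction on the number of variables. -/
lemma mset_refPoint_inc' {s n : ℕ} (t : ℂˣ) (c : Fin s → ℂˣ) (ν : Z s n) (k : Fin s) :
    mset (refPoint t c (ν.inc k)) = {c k} + mset (refPoint t (update c k (t * c k)) ν) := by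
  rw [mset_refPoint, mset_refPoint, ← Finset.add_sum_erase _ _ (Finset.mem_univ k),
    ← Finset.add_sum_erase _ _ (Finset.mem_univ k), Z.inc_self, Finset.sum_range_succ', add_comm _ {_},
    add_assoc]
  congr 2
  · simp
  congr 1
  · simp [pow_succ, mul_assoc]
  · exact Finset.sum_congr rfl fun l hl => by
      rw [Z.inc_of_ne ν (Finset.ne_of_mem_erase hl), update_of_ne (Finset.ne_of_mem_erase hl)]

/-- The multi-index counting how often each value is taken. -/
def Z.count {s n : ℕ} (κ : Fin n → Fin s) : Z s n :=
  ⟨fun k => (Finset.univ.filter fun i => κ i = k).card, by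
    rw [Finset.sum_card_fiberwise_eq_card_filter]; simp⟩

/-- At t = 1 the strings are constant, so reference points are exactly the grid points up to order.
Symmetric functions on the grid are thus indexed by `Z s n`, which gives the dimension. -/
lemma mset_comp_eq_count {s n : ℕ} (c : Fin s → ℂˣ) (κ : Fin n → Fin s) :
    mset (c ∘ κ) = mset (refPoint 1 c (Z.count κ)) := by
  rw [mset_refPoint, mset, ← Finset.sum_fiberwise Finset.univ κ]
  refine Finset.sum_congr rfl fun k _ => ?_
  rw [Finset.sum_congr rfl fun i hi => by
    rw [Function.comp_apply, (Finset.mem_filter.1 hi).2]]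
  simp [Z.count]

lemma Z.exists_count {s n : ℕ} (ν : Z s n) : ∃ κ : Fin n → Fin s, Z.count κ = ν := by
  refine ⟨fun i => (ν.equiv i).1, Subtype.ext (funext fun k => ?_)⟩
  simp only [Z.count, Finset.card_filter]
  rw [ν.equiv.sum_comp (fun y : Σ k, Fin (ν.1 k) => if y.1 = k then 1 else 0), Fintype.sum_sigma,
    Finset.sum_eq_single k]
  · simp
  · intro l _ hl
    simp [hl]
  · simp

lemma Z.count_comp_perm {s n : ℕ} (κ : Fin n → Fin s) (σ : Equiv.Perm (Fin n)) :
    Z.count (fun i => κ (σ i)) = Z.count κ := by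
  refine Subtype.ext (funext fun k => ?_)
  simp only [Z.count, Finset.card_filter]
  exact Equiv.sum_comp σ fun i => if κ i = k then 1 else 0

/-! ### Evaluation of elements of `H p d N` -/

section Spaces

variable {p : ℂˣ} (hp : ‖(p : ℂ)‖ < 1)
include hp

/-- Evaluation at a family of points. -/
def evalAt (p : ℂˣ) (d : ℕ) {N : ℕ} {ι : Type*} (P : ι → Fin N → ℂˣ) : H p d N →ₗ[ℂ] (ι → ℂ) where
  toFun f i := f.1 (P i)
  map_add' _ _ := rfl
  map_smul' _ _ := rfl

variable (h0 : ∃ u, theta p u ≠ 0)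
include h0

omit h0 in
lemma bijective_evalAt_refPoint_one {d N : ℕ} {x : Fin (d + 1) → ℂˣ}
    (hx : ∀ i j, i ≠ j → e p (x i) (x j) ≠ 0) :
    Bijective (evalAt p d fun ν : Z (d + 1) N => refPoint 1 x ν) := by
  constructor
  · rw [← LinearMap.ker_eq_bot, LinearMap.ker_eq_bot']
    intro f hf
    refine Subtype.ext (funext fun z => SepTh.eq_zero_even hp hx (sepTh_of_mem_H f.2) (fun κ => ?_) z)
    rw [IsSym.eq_of_mset_eq f.2.2.1 (mset_comp_eq_count x κ)]
    exact congrFun hf _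
  · intro w
    obtain ⟨g, hg, hgv⟩ := exists_grid_interpolation hp (N := N) hx (v := fun κ => w (Z.count κ))
      (fun σ κ => congrArg w (Z.count_comp_perm κ σ))
    refine ⟨⟨g, hg⟩, funext fun ν => ?_⟩
    obtain ⟨κ, rfl⟩ := ν.exists_count
    rw [← hgv κ]
    exact IsSym.eq_of_mset_eq hg.2.1 (mset_comp_eq_count x κ).symm

lemma exists_equiv_Z (d N : ℕ) : Nonempty (H p d N ≃ₗ[ℂ] (Z (d + 1) N → ℂ)) := by
  obtain ⟨x, -, -, hx⟩ := exists_generic_seq hp h0 ∅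
  exact ⟨LinearEquiv.ofBijective _ (bijective_evalAt_refPoint_one hp (x := fun i : Fin (d + 1) => x i)
    fun i j hij => hx i j (by simpa [Fin.ext_iff] using hij))⟩

lemma finiteDimensional_H (d N : ℕ) : FiniteDimensional ℂ (H p d N) := by
  obtain ⟨E⟩ := exists_equiv_Z hp h0 d N
  exact E.symm.finiteDimensional

lemma finrank_H (d N : ℕ) : Module.finrank ℂ (H p d N) = (d + 1).multichoose N := by
  obtain ⟨E⟩ := exists_equiv_Z hp h0 d N
  rw [E.finrank_eq, Module.finrank_fintype_fun_eq_card, card_Z]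

lemma bijective_evalAt {d N : ℕ} {ι : Type*} [Fintype ι] {P : ι → Fin N → ℂˣ}
    (hc : Fintype.card ι = (d + 1).multichoose N)
    (h : ∀ f ∈ H p d N, (∀ i, f (P i) = 0) → f = 0) : Bijective (evalAt p d P) := by
  have := finiteDimensional_H hp h0 d N
  have hinj : Injective (evalAt p d P) := by
    rw [← LinearMap.ker_eq_bot, LinearMap.ker_eq_bot']
    intro f hf
    exact Subtype.ext (h f.1 f.2 fun i => congrFun hf i)
  refine ⟨hinj, (LinearMap.injective_iff_surjective_of_finrank_eq_finrank ?_).1 hinj⟩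
  rw [finrank_H hp h0, Module.finrank_fintype_fun_eq_card, hc]

/-! ### Restriction and division -/

lemma restrict_mem_H {d N : ℕ} {f : (Fin (N + 1) → ℂˣ) → ℂ} (hf : f ∈ H p d (N + 1)) (c : ℂˣ) :
    (fun z : Fin N → ℂˣ => f (Fin.cons c z : Fin (N + 1) → ℂˣ)) ∈ H p d N := by
  rw [mem_H_iff hp h0] at hf ⊢
  refine ⟨fun σ z => hf.1.eq_of_mset_eq ?_, fun i z => ?_⟩
  · rw [mset_cons, mset_cons]
    congr 1
    exact Equiv.sum_comp σ fun i => ({z i} : Multiset ℂˣ)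
  · have := hf.2 i.succ (Fin.cons c z : Fin (N + 1) → ℂˣ)
    simpa only [Fin.cons_update] using this

lemma mul_prod_e_mem_H {d N : ℕ} {f : (Fin N → ℂˣ) → ℂ} (hf : f ∈ H p d N) (c : ℂˣ) :
    (fun z => f z * ∏ i, e p (z i) c) ∈ H p (d + 1) N := by
  rw [mem_H_iff hp h0] at hf ⊢
  refine ⟨fun σ z => ?_, ?_⟩
  · exact congrArg₂ (· * ·) (hf.1 σ z) (Equiv.prod_comp σ fun i => e p (z i) c)
  · simpa using SepTh.mul hf.2 (SepTh.prod_apply (h := fun _ x => e p x c) fun _ => e_mem_Th hp c)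

/-- The quotient is constructed by interpolating the values f / ∏ e(z_i, c) on a generic grid with d
+ 1 nodes. Adding c as a further node gives a grid fine enough for degree d + 1; at grid points with
a coordinate c both sides vanish. -/
lemma exists_eq_mul_prod_e {d N : ℕ} {f : (Fin N → ℂˣ) → ℂ} (hf : f ∈ H p (d + 1) N) {c : ℂˣ}
    (h : ∀ z, (∃ i, z i = c) → f z = 0) :
    ∃ g ∈ H p d N, ∀ z, f z = g z * ∏ i, e p (z i) c := by
  obtain ⟨x, -, hxc, hx⟩ := exists_generic_seq hp h0 {c}
  have hx' : ∀ i j : Fin (d + 1), i ≠ j → e p (x i) (x j) ≠ 0 :=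
    fun i j hij => hx i j (by simpa [Fin.ext_iff] using hij)
  have hxc' : ∀ n, e p (x n) c ≠ 0 := fun n => by
    rw [e_swap hp, neg_ne_zero]; exact hxc n c (by simp)
  obtain ⟨g, hg, hgv⟩ := exists_grid_interpolation hp (N := N) (x := fun i : Fin (d + 1) => x i) hx'
    (v := fun κ => f (fun i => x (κ i)) / ∏ i, e p (x (κ i)) c) (fun σ κ => by
      exact congrArg₂ (· / ·) (hf.2.1 σ fun i => x (κ i))
        (Equiv.prod_comp σ fun i => e p (x (κ i)) c))
  refine ⟨g, hg, congrFun ?_⟩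
  let x' : Fin (d + 1 + 1) → ℂˣ := Fin.cons c fun i : Fin (d + 1) => x i
  have hx'' : ∀ i j, i ≠ j → e p (x' i) (x' j) ≠ 0 := by
    intro i j
    refine Fin.cases ?_ (fun i => ?_) i <;> refine Fin.cases ?_ (fun j => ?_) j
    · simp
    · intro _; simpa [x'] using hxc _ c (by simp)
    · intro _; simpa [x'] using hxc' _
    · intro hij; simpa [x'] using hx' i j (by simpa using hij)
  refine SepTh.eq_even hp hx'' (sepTh_of_mem_H hf)
    (sepTh_of_mem_H (mul_prod_e_mem_H hp h0 hg c)) fun κ => ?_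
  by_cases hκ : ∃ i, κ i = 0
  · obtain ⟨i, hi⟩ := hκ
    rw [h _ ⟨i, by simp [hi, x']⟩, Finset.prod_eq_zero (Finset.mem_univ i), mul_zero]
    simp [hi, x', e_self]
  · push Not at hκ
    choose κ' hκ' using fun i => Fin.exists_succ_eq.2 (hκ i)
    have h1 : x' ∘ κ = fun i => x (κ' i) := by
      ext i
      simp [← hκ', x']
    have h2 := hgv κ'
    simp only [Function.comp_def] at h2
    rw [h1, h2, div_mul_cancel₀]
    exact Finset.prod_ne_zero_iff.2 fun i _ => hxc' _

omit h0 in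
lemma eq_of_mem_H_zero (h0 : ∃ u, theta p u ≠ 0) {N : ℕ} {f : (Fin N → ℂˣ) → ℂ} (hf : f ∈ H p 0 N)
    (z w : Fin N → ℂˣ) : f z = f w := by
  obtain ⟨x, hx⟩ := h0
  have hc : (fun _ => f fun _ => x) ∈ SepTh p 1 0 N := fun i z => Th.const p _
  have := SepTh.eq_even hp (x := fun _ : Fin (0 + 1) => x)
    (fun i j hij => absurd (Subsingleton.elim (α := Fin 1) i j) hij)
    (sepTh_of_mem_H hf) hc fun κ => rfl
  rw [this]

omit hp h0 in
lemma eq_zero_of_cons {N : ℕ} {f : (Fin (N + 1) → ℂˣ) → ℂ} (hf : IsSym f) {c : ℂˣ}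
    (h : ∀ z : Fin N → ℂˣ, f (Fin.cons c z : Fin (N + 1) → ℂˣ) = 0) (z : Fin (N + 1) → ℂˣ)
    (hz : ∃ i, z i = c) : f z = 0 := by
  obtain ⟨i, rfl⟩ := hz
  rw [← h (i.removeNth z)]
  exact hf.eq_of_mset_eq (by rw [mset_cons, mset_removeNth])

/-! ### Interpolation at the reference points -/

omit hp h0 in
-- Replacing the last parameter by its t-multiple raises its exponents by one, which is paid for by
-- dropping one variable.
lemma IsGeneric.update_last {d N : ℕ} {t : ℂˣ} {c : Fin (d + 1) → ℂˣ} (hc : IsGeneric p t (N + 1) c) :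
    IsGeneric p t N (update c (Fin.last d) (t * c (Fin.last d))) := by
  intro k l hkl i j hij
  have hk : k ≠ Fin.last d := (hkl.trans_le (Fin.le_last l)).ne
  rw [update_of_ne hk]
  rcases eq_or_ne l (Fin.last d) with rfl | hl
  · rw [update_self, ← mul_assoc, ← pow_succ]
    exact hc _ _ hkl _ _ (by omega)
  · rw [update_of_ne hl]
    exact hc _ _ hkl _ _ (by omega)

/-- A function in `H p d N` vanishing at all reference points is zero. -/
lemma eq_zero_of_refPoint {t : ℂˣ} {N d : ℕ} {c : Fin (d + 1) → ℂˣ} (hc : IsGeneric p t N c)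
    {f : (Fin N → ℂˣ) → ℂ} (hf : f ∈ H p d N) (h : ∀ ν : Z (d + 1) N, f (refPoint t c ν) = 0) :
    f = 0 := by
  induction N generalizing d with
  | zero =>
    ext z
    rw [Subsingleton.elim z (refPoint t c (Z.of 0 (by simp))), h, Pi.zero_apply]
  | succ N ihN =>
    induction d generalizing f with
    | zero =>
      ext z
      rw [eq_of_mem_H_zero hp h0 hf z (refPoint t c (Z.of (fun _ => N + 1) (by simp))), h, Pi.zero_apply]
    | succ d ihd =>
      -- Multi-indices with positive last entry control the restriction of f to z_1 = c_last.
      have h1 : (fun z : Fin N → ℂˣ => f (Fin.cons (c (Fin.last _)) z : Fin (N + 1) → ℂˣ)) = 0 := by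
        refine ihN hc.update_last (restrict_mem_H hp h0 hf _) fun ν => ?_
        rw [← h (ν.inc (Fin.last _))]
        exact IsSym.eq_of_mset_eq hf.2.1 (by rw [mset_cons, mset_refPoint_inc'])
      obtain ⟨g, hg, hfg⟩ := exists_eq_mul_prod_e hp h0 hf (eq_zero_of_cons hf.2.1 (congrFun h1))
      -- Multi-indices with last entry 0 control the quotient, which has degree one less and no
      -- longer needs the last parameter.
      have hg0 : g = 0 := by
        refine ihd (c := fun k => c k.castSucc) (fun k l hkl => hc _ _ hkl) hg fun ν => ?_
        have h2 : mset (refPoint t (fun k => c k.castSucc) ν) = mset (refPoint t c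
            (Z.of (n := N + 1) (Fin.snoc (α := fun _ => ℕ) ν.1 0)
              (by simpa [Fin.sum_univ_castSucc] using ν.2))) := by
          simp [mset_refPoint, Fin.sum_univ_castSucc]
        have h3 := hfg (refPoint t (fun k => c k.castSucc) ν)
        rw [IsSym.eq_of_mset_eq hf.2.1 h2, h, eq_comm, mul_eq_zero] at h3
        refine h3.resolve_right (Finset.prod_ne_zero_iff.2 fun i _ => ?_)
        rw [refPoint_apply]
        have h4 := hc (ν.equiv i).1.castSucc (Fin.last _) (Fin.castSucc_lt_last _) (ν.equiv i).2 0
          (by have := (ν.equiv i).2.2; have := ν.le (ν.equiv i).1; omega)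
        simpa using h4
      ext z
      rw [hfg, hg0]
      simp

lemma bijective_evalAt_refPoint {t : ℂˣ} {N d : ℕ} {c : Fin (d + 1) → ℂˣ} (hc : IsGeneric p t N c) :
    Bijective (evalAt p d fun ν : Z (d + 1) N => refPoint t c ν) :=
  bijective_evalAt hp h0 (card_Z _ _) fun _ hf h => eq_zero_of_refPoint hp h0 hc hf h

/-- Existence and uniqueness of the interpolation basis. -/
theorem existsUnique_interpolationBasis {t : ℂˣ} {N d : ℕ} {c : Fin (d + 1) → ℂˣ}
    (hc : IsGeneric p t N c) :
    ∃! E : Module.Basis (Z (d + 1) N) ℂ (H p d N), IsInterpolationBasis t c E := by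
  classical
  let L := LinearEquiv.ofBijective _ (bijective_evalAt_refPoint hp h0 hc)
  have hL : ∀ (f : H p d N) ν, L f ν = f.1 (refPoint t c ν) := fun _ _ => rfl
  refine ⟨Module.Basis.ofEquivFun L, fun μ ν => ?_, fun E hE => ?_⟩
  · rw [← hL, Module.Basis.coe_ofEquivFun, LinearEquiv.apply_symm_apply]
    exact ⟨fun h => by simp [h], fun h => by simp [h.symm]⟩
  · refine Module.Basis.eq_of_apply_eq fun μ => L.injective ?_
    rw [Module.Basis.coe_ofEquivFun, LinearEquiv.apply_symm_apply]
    ext ν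
    rw [hL]
    rcases eq_or_ne μ ν with rfl | h
    · simp [(hE μ μ).1 rfl]
    · simp [(hE μ ν).2 h, h.symm]

/-! ### Interpolation at the injective tuples of a finite set -/

/-- The same double induction, by restriction and division at c ∈ X. Unlike a full grid, tuples of
distinct nodes can all be regular points, so the coboundary formula makes sense at them. -/
lemma eq_zero_of_injective_tuples {N d : ℕ} {X : Finset ℂˣ}
    (hX : ∀ x ∈ X, ∀ y ∈ X, x ≠ y → e p x y ≠ 0) (hcard : d + N ≤ X.card)
    {f : (Fin N → ℂˣ) → ℂ} (hf : f ∈ H p d N)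
    (h : ∀ z : Fin N → ℂˣ, Injective z → (∀ i, z i ∈ X) → f z = 0) : f = 0 := by
  induction N generalizing d X with
  | zero => exact funext fun z => h z (injective_of_subsingleton z) (fun i => i.elim0)
  | succ N ihN =>
    induction d generalizing X f with
    | zero =>
      obtain ⟨κ⟩ := Function.Embedding.nonempty_of_card_le (α := Fin (N + 1)) (β := X)
        (by simpa using hcard)
      ext z
      rw [eq_of_mem_H_zero hp h0 hf z (fun i => (κ i : ℂˣ)), h _ _ fun i => (κ i).2, Pi.zero_apply]
      exact Subtype.val_injective.comp κ.injective
    | succ d ihd =>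
      obtain ⟨c, hc⟩ : X.Nonempty := Finset.card_pos.1 (by omega)
      have hcard' := Finset.card_erase_of_mem hc
      have hX' : ∀ x ∈ X.erase c, ∀ y ∈ X.erase c, x ≠ y → e p x y ≠ 0 := fun x hx y hy =>
        hX x (Finset.mem_of_mem_erase hx) y (Finset.mem_of_mem_erase hy)
      have h1 : (fun z : Fin N → ℂˣ => f (Fin.cons c z : Fin (N + 1) → ℂˣ)) = 0 := by
        refine ihN hX' (by omega) (restrict_mem_H hp h0 hf c) fun z hz hzX => h _ ?_ ?_
        · rw [Fin.cons_injective_iff]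
          refine ⟨?_, hz⟩
          rintro ⟨i, hi⟩
          exact Finset.ne_of_mem_erase (hzX i) hi
        · intro i
          refine Fin.cases ?_ (fun i => ?_) i
          · simpa using hc
          · simpa using Finset.mem_of_mem_erase (hzX i)
      obtain ⟨g, hg, hfg⟩ := exists_eq_mul_prod_e hp h0 hf (eq_zero_of_cons hf.2.1 (congrFun h1))
      have hg0 : g = 0 := by
        refine ihd hX' (by omega) hg fun z hz hzX => ?_
        have h3 := hfg z
        rw [h z hz fun i => Finset.mem_of_mem_erase (hzX i), eq_comm, mul_eq_zero] at h3
        refine h3.resolve_right (Finset.prod_ne_zero_iff.2 fun i _ => ?_)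
        exact hX _ (Finset.mem_of_mem_erase (hzX i)) _ hc (Finset.ne_of_mem_erase (hzX i))
      ext z
      rw [hfg, hg0]
      simp

/-- The increasing `N`-tuples from a sequence of `d + N` points. -/
def subsetPoint {d N : ℕ} (x : Fin (d + N) → ℂˣ) (S : {S : Finset (Fin (d + N)) // S.card = N}) :
    Fin N → ℂˣ :=
  fun i => x (S.1.orderEmbOfFin S.2 i)

omit hp h0 in
lemma exists_mset_subsetPoint {d N : ℕ} (x : Fin (d + N) → ℂˣ) {κ : Fin N → Fin (d + N)}
    (hκ : Injective κ) : ∃ S, mset (x ∘ κ) = mset (subsetPoint x S) := by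
  refine ⟨⟨Finset.univ.image κ, by simp [Finset.card_image_of_injective _ hκ]⟩, ?_⟩
  rw [mset, mset]
  simp only [subsetPoint, Function.comp_apply]
  rw [← Finset.sum_image (f := fun k => ({x k} : Multiset ℂˣ)) fun i _ j _ h => hκ h,
    ← Finset.sum_image (f := fun k => ({x k} : Multiset ℂˣ)) fun i _ j _ h =>
      (Finset.orderEmbOfFin _ _).injective h, Finset.image_orderEmbOfFin_univ]

lemma bijective_evalAt_subsetPoint {d N : ℕ} {x : Fin (d + N) → ℂˣ}
    (hx : ∀ i j, i ≠ j → e p (x i) (x j) ≠ 0) :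
    Bijective (evalAt p d fun S : {S : Finset (Fin (d + N)) // S.card = N} => subsetPoint x S) := by
  classical
  have hinj : Injective x := fun i j hij => by
    by_contra hne
    exact hx i j hne (by rw [hij, e_self])
  refine bijective_evalAt hp h0 ?_ fun f hf h => eq_zero_of_injective_tuples hp h0
    (X := Finset.univ.image x) ?_ ?_ hf ?_
  · rw [Fintype.card_finset_len, Fintype.card_fin, Nat.multichoose_eq]
    congr 1
    omega
  · simp only [Finset.mem_image, Finset.mem_univ, true_and]
    rintro _ ⟨i, rfl⟩ _ ⟨j, rfl⟩ hij
    exact hx i j fun h => hij (by rw [h])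
  · simp [Finset.card_image_of_injective _ hinj]
  · intro z hz hzX
    simp only [Finset.mem_image, Finset.mem_univ, true_and] at hzX
    choose κ hκ using hzX
    have hκ' : x ∘ κ = z := funext hκ
    obtain ⟨S, hS⟩ := exists_mset_subsetPoint x (κ := κ) (Injective.of_comp (f := x) (hκ' ▸ hz))
    rw [← hκ', IsSym.eq_of_mset_eq hf.2.1 hS, h]

end Spaces


/-! ### The antisymmetric theta function of `N` variables -/

/-- The elliptic Vandermonde function of type `C_N`. -/
def vand (p : ℂˣ) {N : ℕ} (z : Fin N → ℂˣ) : ℂ :=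
  (∏ i, oddTheta p (z i)) * ∏ i, ∏ j ∈ Finset.Ioi i, e p (z i) (z j)

/-- The factor of `vand` depending on one of the variables. -/
def vandFactor (p : ℂˣ) {n : ℕ} (x : ℂˣ) (w : Fin n → ℂˣ) : ℂ :=
  oddTheta p x * ∏ j, e p x (w j)

lemma vand_succ (p : ℂˣ) {n : ℕ} (z : Fin (n + 1) → ℂˣ) :
    vand p z = vandFactor p (z 0) (Fin.tail z) * vand p (Fin.tail z) := by
  simp only [vand, vandFactor, Fin.prod_univ_succ, Fin.prod_Ioi_zero, Fin.prod_Ioi_succ, Fin.tail]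
  ring

section Vandermonde

variable {p : ℂˣ} (hp : ‖(p : ℂ)‖ < 1)
include hp

lemma vandFactor_mem_Th {n : ℕ} (w : Fin n → ℂˣ) :
    (fun x => vandFactor p x w) ∈ Th p (-1) (n + 2) := by
  have h := Th.prod (p := p) Finset.univ (f := fun j x => e p x (w j)) fun j _ => e_mem_Th hp (w j)
  have h2 := Th.mul (oddTheta_mem_Th hp) h
  rwa [Finset.card_univ, Fintype.card_fin, mul_one, mul_one, add_comm] at h2

lemma SepTh.const_mul_prod {n : ℕ} (c : ℂ) (x : ℂˣ) :
    (fun w : Fin n → ℂˣ => c * ∏ j, e p x (w j)) ∈ SepTh p 1 1 n :=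
  (SepTh p 1 1 n).smul_mem c (SepTh.prod_apply (h := fun _ y => e p x y) fun _ => e_mem_Th' hp x)

/-- In each variable `oddTheta` contributes degree 2 and sign -1, and each of the N - 1 factors e
contributes degree 1. -/
lemma vand_mem_SepTh (N : ℕ) : (vand p : (Fin N → ℂˣ) → ℂ) ∈ SepTh p (-1) (N + 1) N := by
  induction N with
  | zero => exact fun i => i.elim0
  | succ n ih =>
    have h : (vand p : (Fin (n + 1) → ℂˣ) → ℂ) =
        fun z => vandFactor p (z 0) (Fin.tail z) * vand p (Fin.tail z) := funext (vand_succ p)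
    rw [h]
    refine SepTh.cons (A := fun x w => vandFactor p x w * vand p w) (fun w => ?_) fun x => ?_
    · have := (Th p (-1) (n + 2)).smul_mem (vand p w) (vandFactor_mem_Th hp w)
      convert this using 1
      ext x
      simp [mul_comm]
    · have := SepTh.mul (SepTh.const_mul_prod hp (oddTheta p x) x) ih
      rwa [one_mul, add_comm 1] at this

lemma vand_perm {N : ℕ} (σ : Equiv.Perm (Fin N)) (z : Fin N → ℂˣ) :
    vand p (fun i => z (σ i)) = (Equiv.Perm.sign σ : ℤ) * vand p z := by
  have h := Equiv.Perm.prod_Ioi_comp_eq_sign_mul_prod σ (f := fun i j => e p (z i) (z j))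
    fun i j => e_swap hp _ _
  simp only [vand]
  rw [h, Equiv.prod_comp σ fun i => oddTheta p (z i)]
  ring

omit hp in
lemma eq_zero_of_alternating {N : ℕ} {f : (Fin N → ℂˣ) → ℂ}
    (hf : ∀ (σ : Equiv.Perm (Fin N)) z, f (fun i => z (σ i)) = (Equiv.Perm.sign σ : ℤ) * f z)
    {z : Fin N → ℂˣ} (hz : ¬Injective z) : f z = 0 := by
  simp only [Injective, not_forall] at hz
  obtain ⟨i, j, hij, hne⟩ := hz
  have h := hf (Equiv.swap i j) z
  have h2 : (fun k => z (Equiv.swap i j k)) = z := by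
    ext k
    rw [Equiv.swap_apply_def]
    split_ifs with h1 h2
    · rw [h1, hij]
    · rw [h2, hij]
    · rfl
  rw [h2, Equiv.Perm.sign_swap hne] at h
  have h3 : 2 * f z = 0 := by
    push_cast at h
    linear_combination h
  simpa using h3

omit hp in
lemma isRegular_iff {N : ℕ} (z : Fin N → ℂˣ) :
    IsRegular p z ↔ (∀ i, theta p (z i ^ 2) ≠ 0) ∧ ∀ i j, i ≠ j → e p (z i) (z j) ≠ 0 := by
  simp only [IsRegular, e_ne_zero_iff]

omit hp in
lemma IsRegular.comp {N M : ℕ} {z : Fin N → ℂˣ} (hz : IsRegular p z) {κ : Fin M → Fin N}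
    (hκ : Injective κ) : IsRegular p fun i => z (κ i) :=
  ⟨fun _ => hz.1 _, fun _ _ hij => hz.2 _ _ (hκ.ne hij)⟩

omit hp in
lemma IsRegular.vand_ne_zero {N : ℕ} {z : Fin N → ℂˣ} (hz : IsRegular p z) : vand p z ≠ 0 := by
  rw [isRegular_iff] at hz
  refine mul_ne_zero (Finset.prod_ne_zero_iff.2 fun i _ => ?_)
    (Finset.prod_ne_zero_iff.2 fun i _ => Finset.prod_ne_zero_iff.2 fun j hj => ?_)
  · simpa [oddTheta] using hz.1 i
  · exact hz.2 _ _ (Finset.mem_Ioi.1 hj).ne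

end Vandermonde

/-! ### The coboundary operator -/

/-- `f_i^+` in terms of the distinguished variable `x = z_i` and the tuple `w` of the others. -/
def plusTerm {m n : ℕ} (s : ℕ) (p t : ℂˣ) (a : Fin m → ℂˣ) (x : ℂˣ) (w : Fin n → ℂˣ) : ℂ :=
  (∏ k, theta p (a k * x)) / ((x : ℂ) ^ s * theta p (x ^ 2)) *
    ∏ j, (theta p (t * x * w j) * theta p (t * x * (w j)⁻¹)) /
        (theta p (x * w j) * theta p (x * (w j)⁻¹))

lemma prod_erase_eq_prod_succAbove {n : ℕ} (i : Fin (n + 1)) (f : Fin (n + 1) → ℂ) :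
    ∏ j ∈ Finset.univ.erase i, f j = ∏ j, f (i.succAbove j) := by
  have : Finset.univ.erase i = Finset.univ.map i.succAboveEmb := by
    ext j
    simp only [Finset.mem_erase, Finset.mem_univ, and_true, Finset.mem_map, true_and,
      Fin.coe_succAboveEmb]
    exact Fin.exists_succAbove_eq_iff.symm
  rw [this, Finset.prod_map]
  rfl

lemma fPlus_eq {m n : ℕ} (s : ℕ) (p t : ℂˣ) (a : Fin m → ℂˣ) (i : Fin (n + 1))
    (z : Fin (n + 1) → ℂˣ) : fPlus s p t a i z = plusTerm s p t a (z i) (i.removeNth z) := by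
  rw [fPlus, plusTerm, prod_erase_eq_prod_succAbove]
  rfl

lemma plusTerm_inv_right {m n : ℕ} (s : ℕ) (p t : ℂˣ) (a : Fin m → ℂˣ) (x : ℂˣ) (w : Fin n → ℂˣ) :
    plusTerm s p t a x (fun j => (w j)⁻¹) = plusTerm s p t a x w := by
  simp only [plusTerm, inv_inv]
  congr 1
  refine Finset.prod_congr rfl fun j _ => ?_
  rw [mul_comm (theta p (t * x * (w j)⁻¹)), mul_comm (theta p (x * (w j)⁻¹))]

lemma fMinus_eq {m n : ℕ} (s : ℕ) (p t : ℂˣ) (a : Fin m → ℂˣ) (i : Fin (n + 1))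
    (z : Fin (n + 1) → ℂˣ) : fMinus s p t a i z = plusTerm s p t a (z i)⁻¹ (i.removeNth z) := by
  rw [fMinus, fPlus_eq, ← plusTerm_inv_right]
  rfl

/-- A summand of the coboundary of `φ`. -/
def coboundaryTerm {m n : ℕ} (s : ℕ) (p t : ℂˣ) (a : Fin m → ℂˣ) (φ : (Fin n → ℂˣ) → ℂ)
    (x : ℂˣ) (w : Fin n → ℂˣ) : ℂ :=
  (plusTerm s p t a x w + plusTerm s p t a x⁻¹ w) * φ w

/-- The pointwise coboundary of `φ`. -/
def coboundary {m n : ℕ} (s : ℕ) (p t : ℂˣ) (a : Fin m → ℂˣ) (φ : (Fin n → ℂˣ) → ℂ)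
    (z : Fin (n + 1) → ℂˣ) : ℂ :=
  ∑ i, coboundaryTerm s p t a φ (z i) (i.removeNth z)

lemma coboundary_eq {m n : ℕ} (s : ℕ) (p t : ℂˣ) (a : Fin m → ℂˣ) (φ : (Fin n → ℂˣ) → ℂ)
    (z : Fin (n + 1) → ℂˣ) : coboundary s p t a φ z =
      ∑ i, (fPlus s p t a i z + fMinus s p t a i z) * φ (i.removeNth z) := by
  simp only [coboundary, coboundaryTerm, fPlus_eq, fMinus_eq]

lemma coboundaryTerm_congr {m n : ℕ} (s : ℕ) (p t : ℂˣ) (a : Fin m → ℂˣ) {φ : (Fin n → ℂˣ) → ℂ}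
    (hφ : IsSym φ) (x : ℂˣ) {w w' : Fin n → ℂˣ} (h : mset w = mset w') :
    coboundaryTerm s p t a φ x w = coboundaryTerm s p t a φ x w' := by
  obtain ⟨σ, rfl⟩ := exists_perm_of_mset_eq h
  simp only [coboundaryTerm, plusTerm, Function.comp_apply]
  rw [Equiv.prod_comp σ fun j => (theta p (t * x * w' j) * theta p (t * x * (w' j)⁻¹)) /
        (theta p (x * w' j) * theta p (x * (w' j)⁻¹)),
    Equiv.prod_comp σ fun j => (theta p (t * x⁻¹ * w' j) * theta p (t * x⁻¹ * (w' j)⁻¹)) /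
        (theta p (x⁻¹ * w' j) * theta p (x⁻¹ * (w' j)⁻¹))]
  congr 1
  exact hφ σ w'

lemma mset_comp_perm {α : Type*} {N : ℕ} (σ : Equiv.Perm (Fin N)) (z : Fin N → α) :
    mset (fun i => z (σ i)) = mset z :=
  Equiv.sum_comp σ fun i => ({z i} : Multiset α)

lemma mset_removeNth_comp {α : Type*} {n : ℕ} (σ : Equiv.Perm (Fin (n + 1))) (z : Fin (n + 1) → α)
    (i : Fin (n + 1)) : mset (i.removeNth fun i => z (σ i)) = mset ((σ i).removeNth z) := by
  have h1 := mset_removeNth i fun i => z (σ i)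
  rw [mset_comp_perm, ← mset_removeNth (σ i) z] at h1
  exact add_left_cancel h1

lemma isSym_coboundary {m n : ℕ} (s : ℕ) (p t : ℂˣ) (a : Fin m → ℂˣ) {φ : (Fin n → ℂˣ) → ℂ}
    (hφ : IsSym φ) : IsSym (coboundary s p t a φ) := by
  intro σ z
  simp only [coboundary]
  rw [← Equiv.sum_comp σ fun i => coboundaryTerm s p t a φ (z i) (i.removeNth z)]
  exact Finset.sum_congr rfl fun i _ => coboundaryTerm_congr s p t a hφ _ (mset_removeNth_comp σ z i)

/-- The numerator of `f_i^+`. -/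
def numer {m n : ℕ} (s : ℕ) (p t : ℂˣ) (a : Fin m → ℂˣ) (x : ℂˣ) (w : Fin n → ℂˣ) : ℂ :=
  ((x : ℂ) ^ (s + n + 1))⁻¹ * (∏ k, theta p (a k * x)) *
    ∏ j, (theta p (t * x * w j) * theta p (t * x * (w j)⁻¹))

/-- Up to a monomial, `vandFactor` is the theta part of the denominator of f_i^+. -/
lemma vandFactor_mul_plusTerm {m n : ℕ} (s : ℕ) {p : ℂˣ} (t : ℂˣ) (a : Fin m → ℂˣ) {x : ℂˣ}
    {w : Fin n → ℂˣ} (hx : theta p (x ^ 2) ≠ 0) (hw : ∀ j, e p x (w j) ≠ 0) :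
    vandFactor p x w * plusTerm s p t a x w = numer s p t a x w := by
  simp only [vandFactor, plusTerm, numer, oddTheta, e, Finset.prod_div_distrib,
    Finset.prod_mul_distrib, Finset.prod_const, Finset.card_univ, Fintype.card_fin, inv_pow]
  simp only [e_ne_zero_iff] at hw
  have h1 : ∏ j, theta p (x * w j) ≠ 0 := Finset.prod_ne_zero_iff.2 fun j _ => (hw j).1
  have h2 : ∏ j, theta p (x * (w j)⁻¹) ≠ 0 := Finset.prod_ne_zero_iff.2 fun j _ => (hw j).2
  have h3 := x.ne_zero
  field_simp
  ring

section Coboundary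

variable {p : ℂˣ} (hp : ‖(p : ℂ)‖ < 1)
include hp

lemma vandFactor_inv {n : ℕ} (x : ℂˣ) (w : Fin n → ℂˣ) :
    vandFactor p x⁻¹ w = -vandFactor p x w := by
  simp [vandFactor, oddTheta_inv hp, e_inv_left hp]

omit hp in
lemma theta_mul_theta_eq (t x w : ℂˣ) :
    theta p (t * x * w) * theta p (t * x * w⁻¹) = (t * x : ℂ) * e p (t * x) w := by
  have := t.ne_zero; have := x.ne_zero
  rw [e]; push_cast; field_simp

variable {d n : ℕ} {t : ℂˣ} {a : Fin (2 * (d + 1) + 2) → ℂˣ}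
  (hbal : t ^ (2 * n) * ∏ k, a k = 1)

include hbal in
-- The shift x ↦ px produces the constant (t^(2n) ∏ a_k)^(-1), and the balancing condition makes it
-- 1.
lemma numer_p_mul (x : ℂˣ) (w : Fin n → ℂˣ) : numer (d + 1) p t a (p * x) w =
    numer (d + 1) p t a x w * ((p : ℂ) * (x : ℂ) ^ 2) ^ (-((d + n + 2 : ℕ) : ℤ)) := by
  have hb : (t : ℂ) ^ (2 * n) * ∏ k, (a k : ℂ) = 1 := by
    have := congrArg (Units.val) hbal
    simpa using this
  have h1 : ∏ k, theta p (a k * (p * x)) =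
      (∏ k, (a k : ℂ))⁻¹ * ((x : ℂ) ^ (2 * (d + 1) + 2))⁻¹ * ∏ k, theta p (a k * x) := by
    have : ∀ k, theta p (a k * (p * x)) = -1 * ((a k : ℂ)⁻¹ * (x : ℂ)⁻¹) * theta p (a k * x) := by
      intro k
      rw [mul_left_comm, theta_p_mul hp]
      push_cast
      rw [mul_inv]; ring
    simp only [this, Finset.prod_mul_distrib, Finset.prod_const, Finset.card_univ,
      Fintype.card_fin, Finset.prod_inv_distrib, inv_pow]
    rw [(show Even (2 * (d + 1) + 2) from ⟨d + 2, by ring⟩).neg_one_pow]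
    ring
  have h2 : ∏ j, (theta p (t * (p * x) * w j) * theta p (t * (p * x) * (w j)⁻¹)) =
      ((t : ℂ) ^ (2 * n))⁻¹ * ((x : ℂ) ^ (2 * n))⁻¹ *
        ∏ j, (theta p (t * x * w j) * theta p (t * x * (w j)⁻¹)) := by
    have : ∀ j, theta p (t * (p * x) * w j) * theta p (t * (p * x) * (w j)⁻¹) =
        (((t : ℂ) ^ 2)⁻¹ * ((x : ℂ) ^ 2)⁻¹) *
          (theta p (t * x * w j) * theta p (t * x * (w j)⁻¹)) := by
      intro j
      rw [theta_mul_theta_eq, theta_mul_theta_eq, mul_left_comm, e_p_mul hp]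
      have := t.ne_zero; have := x.ne_zero; have := p.ne_zero
      push_cast
      field_simp
    simp only [this, Finset.prod_mul_distrib (f := fun _ => ((t : ℂ) ^ 2)⁻¹ * ((x : ℂ) ^ 2)⁻¹),
      Finset.prod_const, Finset.card_univ, Fintype.card_fin, mul_pow, inv_pow, ← pow_mul]
  have ht := t.ne_zero; have hx := x.ne_zero; have hpp := p.ne_zero
  have hA : (∏ k, (a k : ℂ)) ≠ 0 := fun h => by simp [h] at hb
  have hA' : (∏ k, (a k : ℂ))⁻¹ = (t : ℂ) ^ (2 * n) := by
    exact inv_eq_of_mul_eq_one_left hb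
  rw [numer, numer, h1, h2, hA', zpow_neg, zpow_natCast]
  push_cast
  field_simp
  ring

lemma isHol_numer (w : Fin n → ℂˣ) : IsHol fun x => numer (d + 1) p t a x w := by
  have hθ := isHol_theta hp
  have h : ∀ c : ℂˣ, IsHol fun x => theta p (t * x * c) := fun c =>
    (hθ.comp_mul_right c).comp_mul_left t
  exact ((isHol_inv_pow _).mul (IsHol.prod _ fun k _ => hθ.comp_mul_left (a k))).mul
    (IsHol.prod _ fun j _ => (h _).mul (h _))

include hbal in
-- Since `vandFactor` is odd in x, this difference is the numerator of f_i^+ + f_i^-.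
lemma numer_sub_mem_Th (w : Fin n → ℂˣ) :
    (fun x => numer (d + 1) p t a x w - numer (d + 1) p t a x⁻¹ w) ∈ Th p (-1) (d + n + 2) := by
  have h := isHol_numer hp (t := t) (a := a) w
  refine ⟨h.sub h.comp_inv, fun x => by simp, fun x => ?_⟩
  -- Quasi-periodicity at (px)⁻¹, whose p-multiple is x⁻¹, transfers the multiplier to the reflected
  -- term.
  have h1 := numer_p_mul hp hbal (p * x)⁻¹ w
  rw [show p * (p * x)⁻¹ = x⁻¹ by simp] at h1
  have h2 : numer (d + 1) p t a (p * x)⁻¹ w = numer (d + 1) p t a x⁻¹ w *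
      ((p : ℂ) * (x : ℂ) ^ 2) ^ (-((d + n + 2 : ℕ) : ℤ)) := by
    have h3 : (p : ℂ) * (((p * x)⁻¹ : ℂˣ) : ℂ) ^ 2 = ((p : ℂ) * (x : ℂ) ^ 2)⁻¹ := by
      have := x.ne_zero; have := p.ne_zero
      push_cast
      field_simp
    rw [h1, h3, inv_zpow, ← zpow_neg, neg_neg, mul_assoc, ← zpow_add₀ (by simp)]
    simp
  dsimp only
  rw [numer_p_mul hp hbal, h2]
  ring

lemma numer_mem_SepTh (x : ℂˣ) :
    (fun w => numer (d + 1) p t a x w) ∈ SepTh p 1 1 n := by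
  have := SepTh.const_mul_prod hp (n := n) (((x : ℂ) ^ (d + 1 + n + 1))⁻¹ *
    (∏ k, theta p (a k * x)) * (t * x : ℂ) ^ n) (t * x)
  convert this using 1
  ext w
  simp only [numer, theta_mul_theta_eq, Finset.prod_mul_distrib, Finset.prod_const,
    Finset.card_univ, Fintype.card_fin]
  ring

/-- The unsymmetrized numerator of the coboundary. -/
def coboundarySeed (p t : ℂˣ) (a : Fin (2 * (d + 1) + 2) → ℂˣ) (φ : (Fin n → ℂˣ) → ℂ)
    (z : Fin (n + 1) → ℂˣ) : ℂ :=
  (numer (d + 1) p t a (z 0) (Fin.tail z) - numer (d + 1) p t a (z 0)⁻¹ (Fin.tail z)) *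
    φ (Fin.tail z) * vand p (Fin.tail z)

/-- The antisymmetrization of `coboundarySeed`. -/
def coboundaryNumer (p t : ℂˣ) (a : Fin (2 * (d + 1) + 2) → ℂˣ) (φ : (Fin n → ℂˣ) → ℂ)
    (z : Fin (n + 1) → ℂˣ) : ℂ :=
  ∑ σ : Equiv.Perm (Fin (n + 1)), ((Equiv.Perm.sign σ : ℤ) : ℂ) *
    coboundarySeed p t a φ fun i => z (σ i)

include hbal in
-- The degree is the same in every variable: d + n + 2 in the first, and 1 + d + (n + 1) in the
-- others from the numerator, φ and `vand`.
lemma coboundarySeed_mem_SepTh {φ : (Fin n → ℂˣ) → ℂ} (hφ : φ ∈ SepTh p 1 d n) :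
    coboundarySeed p t a φ ∈ SepTh p (-1) (d + n + 2) (n + 1) := by
  refine SepTh.cons (A := fun x w => (numer (d + 1) p t a x w - numer (d + 1) p t a x⁻¹ w) *
    φ w * vand p w) (fun w => ?_) fun x => ?_
  · have := (Th p (-1) (d + n + 2)).smul_mem (φ w * vand p w) (numer_sub_mem_Th hp hbal w)
    convert this using 1
    ext x
    simp only [Pi.smul_apply, smul_eq_mul]
    ring
  · have h1 := (SepTh p 1 1 n).sub_mem (numer_mem_SepTh hp (t := t) (a := a) x)
      (numer_mem_SepTh hp (t := t) (a := a) x⁻¹)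
    have := SepTh.mul (SepTh.mul h1 hφ) (vand_mem_SepTh hp n)
    rwa [one_mul, one_mul, show 1 + d + (n + 1) = d + n + 2 by ring] at this

include hbal in
lemma coboundaryNumer_mem_SepTh {φ : (Fin n → ℂˣ) → ℂ} (hφ : φ ∈ SepTh p 1 d n) :
    coboundaryNumer p t a φ ∈ SepTh p (-1) (d + n + 2) (n + 1) := by
  have h : coboundaryNumer p t a φ = ∑ σ : Equiv.Perm (Fin (n + 1)),
      ((Equiv.Perm.sign σ : ℤ) : ℂ) • fun z : Fin (n + 1) → ℂˣ =>
        coboundarySeed p t a φ fun i => z (σ i) := by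
    ext z
    simp [coboundaryNumer]
  rw [h]
  exact Submodule.sum_mem _ fun σ _ => Submodule.smul_mem _ _
    (SepTh.comp_perm (coboundarySeed_mem_SepTh hp hbal hφ) σ)

omit hp in
lemma coboundaryNumer_perm (φ : (Fin n → ℂˣ) → ℂ) (τ : Equiv.Perm (Fin (n + 1)))
    (z : Fin (n + 1) → ℂˣ) : coboundaryNumer p t a φ (fun i => z (τ i)) =
      (Equiv.Perm.sign τ : ℤ) * coboundaryNumer p t a φ z := by
  rw [coboundaryNumer, coboundaryNumer, Finset.mul_sum]
  refine Fintype.sum_equiv (Equiv.mulLeft τ) _ _ fun σ => ?_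
  rw [Equiv.coe_mulLeft, Equiv.Perm.sign_mul, ← mul_assoc]
  have h : (((Equiv.Perm.sign τ : ℤˣ) : ℤ) : ℂ) * ((Equiv.Perm.sign τ : ℤˣ) : ℤ) = 1 := by
    rw [← Int.cast_mul, ← Units.val_mul, Int.units_mul_self]
    simp
  push_cast
  rw [← mul_assoc, h, one_mul]
  rfl

lemma coboundarySeed_eq {z : Fin (n + 1) → ℂˣ} (hz : IsRegular p z) (φ : (Fin n → ℂˣ) → ℂ) :
    coboundarySeed p t a φ z =
      vand p z * coboundaryTerm (d + 1) p t a φ (z 0) (Fin.tail z) := by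
  rw [isRegular_iff] at hz
  have h1 := vandFactor_mul_plusTerm (d + 1) t a (hz.1 0) (w := Fin.tail z)
    fun j => hz.2 _ _ (Fin.succ_ne_zero j).symm
  have h2 := vandFactor_mul_plusTerm (d + 1) t a (p := p) (x := (z 0)⁻¹) (w := Fin.tail z)
    (by rw [inv_pow, theta_inv hp]; simpa using hz.1 0)
    fun j => by rw [e_inv_left hp]; exact hz.2 _ _ (Fin.succ_ne_zero j).symm
  rw [vandFactor_inv hp] at h2
  rw [coboundarySeed, ← h1, ← h2, vand_succ, coboundaryTerm]
  ring

omit hp in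
lemma sum_perm_apply_zero (F : Fin (n + 1) → ℂ) :
    ∑ σ : Equiv.Perm (Fin (n + 1)), F (σ 0) = n.factorial * ∑ i, F i := by
  rw [← Equiv.sum_comp Equiv.Perm.decomposeFin.symm, Fintype.sum_prod_type, Finset.mul_sum]
  simp [Fintype.card_perm]

/-- The signs cancel against those of `vand`, and each choice of distinguished variable comes from
n! permutations. -/
lemma coboundaryNumer_eq {z : Fin (n + 1) → ℂˣ} (hz : IsRegular p z) {φ : (Fin n → ℂˣ) → ℂ}
    (hφ : IsSym φ) : coboundaryNumer p t a φ z =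
      n.factorial * (vand p z * coboundary (d + 1) p t a φ z) := by
  rw [coboundary, mul_left_comm,
    ← sum_perm_apply_zero fun i => coboundaryTerm (d + 1) p t a φ (z i) (i.removeNth z),
    coboundaryNumer, Finset.mul_sum]
  refine Finset.sum_congr rfl fun σ _ => ?_
  have h : (((Equiv.Perm.sign σ : ℤˣ) : ℤ) : ℂ) * ((Equiv.Perm.sign σ : ℤˣ) : ℤ) = 1 := by
    rw [← Int.cast_mul, ← Units.val_mul, Int.units_mul_self]
    simp
  rw [coboundarySeed_eq hp (hz.comp σ.injective), vand_perm hp, ← mul_assoc, ← mul_assoc, h, one_mul]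
  congr 1
  exact coboundaryTerm_congr _ _ _ _ hφ _ (mset_removeNth_comp σ z 0)

variable (h0 : ∃ u, theta p u ≠ 0)
include h0

include hbal in
/-- The symmetrized coboundary operator exists. -/
theorem exists_symCoboundary :
    ∃ D : H p d n →ₗ[ℂ] H p d (n + 1), ∀ (φ : H p d n) (z : Fin (n + 1) → ℂˣ), IsRegular p z →
      (D φ).1 z = coboundary (d + 1) p t a φ.1 z := by
  obtain ⟨x, hx2, -, hx⟩ := exists_generic_seq hp h0 ∅
  have hx' : ∀ i j : Fin (d + (n + 1)), i ≠ j → e p (x i) (x j) ≠ 0 := fun i j hij =>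
    hx i j (by simpa [Fin.ext_iff] using hij)
  let L := LinearEquiv.ofBijective _ (bijective_evalAt_subsetPoint hp h0 hx')
  -- The operator is defined by interpolating the pointwise coboundary at regular points; the rest
  -- of the proof shows that the formula then holds at all regular points.
  let C : H p d n →ₗ[ℂ] ({S : Finset (Fin (d + (n + 1))) // S.card = n + 1} → ℂ) :=
    { toFun := fun φ S => coboundary (d + 1) p t a φ.1 (subsetPoint (fun i => x i) S)
      map_add' := fun φ ψ => by
        ext S
        simp [coboundary, coboundaryTerm, mul_add, Finset.sum_add_distrib]
      map_smul' := fun c φ => by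
        ext S
        simp [coboundary, coboundaryTerm, Finset.mul_sum, mul_left_comm] }
  refine ⟨L.symm.toLinearMap ∘ₗ C, fun φ => ?_⟩
  set ψ := (L.symm.toLinearMap ∘ₗ C) φ with hψ
  have hψS : ∀ S, ψ.1 (subsetPoint (fun i : Fin (d + (n + 1)) => x i) S) =
      coboundary (d + 1) p t a φ.1 (subsetPoint (fun i => x i) S) := by
    intro S
    have : L ψ = C φ := by simp [hψ]
    exact congrFun this S
  have hfac : (n.factorial : ℂ) ≠ 0 := by exact_mod_cast n.factorial_ne_zero
  have hmem : (fun z => n.factorial * (vand p z * ψ.1 z)) ∈ SepTh p (-1) (d + n + 2) (n + 1) := by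
    have h1 := SepTh.mul (vand_mem_SepTh hp (n + 1)) (sepTh_of_mem_H ψ.2)
    rw [mul_one, show n + 1 + 1 + d = d + n + 2 by ring] at h1
    exact Submodule.smul_mem _ (n.factorial : ℂ) h1
  -- Both sides are odd of degree d + n + 2, so d + n + 1 nodes suffice. On distinct nodes they
  -- agree by the choice of ψ; on repeated nodes both vanish because they are alternating.
  have key := SepTh.eq_odd hp (D := d + n) (x := fun i => x i) hx' (fun i => hx2 i)
    (coboundaryNumer_mem_SepTh hp hbal (sepTh_of_mem_H φ.2)) hmem fun κ => by
      by_cases hκ : Injective κ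
      · have hreg : IsRegular p ((fun i : Fin (d + n + 1) => x i) ∘ κ) :=
          (isRegular_iff _).2 ⟨fun i => hx2 _, fun i j hij => hx' _ _ (hκ.ne hij)⟩
        obtain ⟨S, hS⟩ := exists_mset_subsetPoint (d := d) (fun i => x i) hκ
        rw [coboundaryNumer_eq hp hreg φ.2.2.1]
        have h1 := IsSym.eq_of_mset_eq ψ.2.2.1 hS
        have h2 := IsSym.eq_of_mset_eq (isSym_coboundary (d + 1) p t a φ.2.2.1) hS
        rw [hψS] at h1
        rw [← h2] at h1
        exact congrArg (fun y => _ * (_ * y)) h1.symm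
      · have hni : ¬Injective ((fun i : Fin (d + n + 1) => x i) ∘ κ) := fun h => hκ (Injective.of_comp h)
        rw [eq_zero_of_alternating (coboundaryNumer_perm φ.1) hni,
          eq_zero_of_alternating (vand_perm hp) hni]
        simp
  intro z hz
  have h1 := congrFun key z
  rw [coboundaryNumer_eq hp hz φ.2.2.1] at h1
  exact (mul_left_cancel₀ hz.vand_ne_zero (mul_left_cancel₀ hfac h1)).symm

end Coboundary


/-! ### The coboundary at the reference points -/

lemma prod_refPoint {s n : ℕ} (t : ℂˣ) (c : Fin s → ℂˣ) (ν : Z s n) (F : ℂˣ → ℂ) :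
    ∏ i, F (refPoint t c ν i) = ∏ k, ∏ j ∈ Finset.range (ν.1 k), F (t ^ j * c k) := by
  refine (ν.equiv.prod_comp (fun x : Σ k, Fin (ν.1 k) => F (t ^ (x.2 : ℕ) * c x.1))).trans ?_
  simp only [Fintype.prod_sigma, Finset.prod_range]

/-- Position `i` of a reference point is the last one in its string. -/
def IsLast {s n : ℕ} (ν : Z s n) (i : Fin n) : Prop :=
  ((ν.equiv i).2 : ℕ) + 1 = ν.1 (ν.equiv i).1

instance {s n : ℕ} (ν : Z s n) (i : Fin n) : Decidable (IsLast ν i) :=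
  inferInstanceAs (Decidable (_ = _))

lemma IsLast.t_mul {s n : ℕ} {ν : Z s n} {i : Fin n} (h : IsLast ν i) (t : ℂˣ) (c : Fin s → ℂˣ) :
    t * refPoint t c ν i = t ^ ν.1 (ν.equiv i).1 * c (ν.equiv i).1 := by
  have h' : ((ν.equiv i).2 : ℕ) + 1 = ν.1 (ν.equiv i).1 := h
  rw [refPoint_apply, ← mul_assoc, ← pow_succ']
  exact congrArg (fun k : ℕ => t ^ k * c (ν.equiv i).1) h'

lemma exists_eq_t_mul {s n : ℕ} {ν : Z s (n + 1)} {i : Fin (n + 1)} (h : ¬IsLast ν i) (t : ℂˣ)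
    (c : Fin s → ℂˣ) : ∃ j, i.removeNth (refPoint t c ν) j = t * refPoint t c ν i := by
  have h1 : ((ν.equiv i).2 : ℕ) + 1 < ν.1 (ν.equiv i).1 := lt_of_le_of_ne (ν.equiv i).2.2 h
  let i' := ν.equiv.symm ⟨(ν.equiv i).1, ⟨((ν.equiv i).2 : ℕ) + 1, h1⟩⟩
  have hE : ν.equiv i' = ⟨(ν.equiv i).1, ⟨((ν.equiv i).2 : ℕ) + 1, h1⟩⟩ := by simp [i']
  have hne : i' ≠ i := by
    intro h2
    rw [h2] at hE
    have := congrArg (fun y : Σ k, Fin (ν.1 k) => (y.2 : ℕ)) hE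
    simp at this
  obtain ⟨j, hj⟩ := Fin.exists_succAbove_eq hne
  refine ⟨j, ?_⟩
  rw [Fin.removeNth_apply, hj, refPoint_apply, refPoint_apply, hE, pow_succ', mul_assoc]

lemma exists_t_mul_eq {s n : ℕ} {ν : Z s (n + 1)} {i : Fin (n + 1)} (h : ((ν.equiv i).2 : ℕ) ≠ 0)
    (t : ℂˣ) (c : Fin s → ℂˣ) : ∃ j, t * i.removeNth (refPoint t c ν) j = refPoint t c ν i := by
  have h1 : ((ν.equiv i).2 : ℕ) - 1 < ν.1 (ν.equiv i).1 := by have := (ν.equiv i).2.2; omega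
  let i' := ν.equiv.symm ⟨(ν.equiv i).1, ⟨((ν.equiv i).2 : ℕ) - 1, h1⟩⟩
  have hE : ν.equiv i' = ⟨(ν.equiv i).1, ⟨((ν.equiv i).2 : ℕ) - 1, h1⟩⟩ := by simp [i']
  have hne : i' ≠ i := by
    intro h2
    rw [h2] at hE
    have := congrArg (fun y : Σ k, Fin (ν.1 k) => (y.2 : ℕ)) hE
    simp only at this
    omega
  obtain ⟨j, hj⟩ := Fin.exists_succAbove_eq hne
  refine ⟨j, ?_⟩
  rw [Fin.removeNth_apply, hj, refPoint_apply, refPoint_apply, hE, ← mul_assoc, ← pow_succ']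
  simp only
  congr 2
  omega

/-- The successor t x of x = z_i is also a coordinate, so the numerator contains θ(tx/(tx)) = θ(1) =
0. -/
lemma plusTerm_eq_zero_of_not_isLast {m s n : ℕ} {p t : ℂˣ} (a : Fin m → ℂˣ) (c : Fin s → ℂˣ)
    {ν : Z s (n + 1)} {i : Fin (n + 1)} (h : ¬IsLast ν i) :
    plusTerm s p t a (refPoint t c ν i) (i.removeNth (refPoint t c ν)) = 0 := by
  obtain ⟨j, hj⟩ := exists_eq_t_mul h t c
  rw [plusTerm, Finset.prod_eq_zero (Finset.mem_univ j), mul_zero]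
  rw [hj, mul_inv_cancel, theta_one, mul_zero, zero_div]

/-- If x starts its string then x = a_k and θ(a_k/x) = 0. Otherwise its predecessor x/t is a
coordinate and θ(t x⁻¹ · x/t) = 0. -/
lemma plusTerm_inv_eq_zero {m s n : ℕ} {p t : ℂˣ} (hs : s ≤ m) (a : Fin m → ℂˣ)
    (ν : Z s (n + 1)) (i : Fin (n + 1)) :
    plusTerm s p t a (refPoint t (initial s hs a) ν i)⁻¹
      (i.removeNth (refPoint t (initial s hs a) ν)) = 0 := by
  by_cases h : ((ν.equiv i).2 : ℕ) = 0
  · rw [plusTerm, Finset.prod_eq_zero (Finset.mem_univ (Fin.castLE hs (ν.equiv i).1)), zero_div,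
      zero_mul]
    rw [refPoint_apply, h, pow_zero, one_mul, initial, mul_inv_cancel, theta_one]
  · obtain ⟨j, hj⟩ := exists_t_mul_eq h t (initial s hs a)
    rw [plusTerm, Finset.prod_eq_zero (Finset.mem_univ j), mul_zero]
    rw [mul_right_comm, hj, mul_inv_cancel, theta_one, zero_mul, zero_div]

/-- The value of `f_i^+` at a reference point, for a last position `i`, after cancellation. -/
def refCoeff {m s n : ℕ} (p t : ℂˣ) (hs : s ≤ m) (a : Fin m → ℂˣ) (ν : Z s (n + 1))
    (i : Fin (n + 1)) : ℂ :=
  ((refPoint t (initial s hs a) ν i : ℂ) ^ s)⁻¹ *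
    (∏ k ∈ Finset.univ.filter fun k : Fin m => s ≤ (k : ℕ),
      theta p (a k * refPoint t (initial s hs a) ν i)) *
    (∏ l ∈ Finset.univ.erase (ν.equiv i).1,
      theta p (t ^ ν.1 l * initial s hs a l * refPoint t (initial s hs a) ν i)) *
    ∏ j, (theta p (t * refPoint t (initial s hs a) ν i *
        (i.removeNth (refPoint t (initial s hs a) ν) j)⁻¹) /
      theta p (refPoint t (initial s hs a) ν i *
        (i.removeNth (refPoint t (initial s hs a) ν) j)⁻¹))

lemma prod_initial {m s : ℕ} (hs : s ≤ m) (F : Fin m → ℂ) :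
    ∏ k, F k = (∏ l : Fin s, F (Fin.castLE hs l)) *
      ∏ k ∈ Finset.univ.filter fun k : Fin m => s ≤ (k : ℕ), F k := by
  rw [← Finset.prod_filter_mul_prod_filter_not Finset.univ (fun k : Fin m => (k : ℕ) < s)]
  congr 1
  · have : (Finset.univ.filter fun k : Fin m => (k : ℕ) < s) =
        Finset.univ.map (Fin.castLEEmb hs) := by
      ext k
      simp only [Finset.mem_filter, Finset.mem_univ, true_and, Finset.mem_map, Fin.castLEEmb_apply]
      exact ⟨fun h => ⟨⟨k, h⟩, rfl⟩, fun ⟨l, hl⟩ => by rw [← hl]; exact l.2⟩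
    rw [this, Finset.prod_map]
    rfl
  · simp only [not_lt]

/-- Along each string the factors shifted by t coincide with the unshifted ones except at the two
ends. -/
lemma telescope {s n : ℕ} {p t : ℂˣ} (c : Fin s → ℂˣ) (ν : Z s n) (x : ℂˣ) :
    (∏ l, theta p (c l * x)) * ∏ i, theta p (t * x * refPoint t c ν i) =
      (∏ i, theta p (x * refPoint t c ν i)) * ∏ l, theta p (t ^ ν.1 l * c l * x) := by
  rw [prod_refPoint t c ν fun y => theta p (t * x * y), prod_refPoint t c ν fun y => theta p (x * y),
    ← Finset.prod_mul_distrib, ← Finset.prod_mul_distrib]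
  refine Finset.prod_congr rfl fun l _ => ?_
  have h1 := Finset.prod_range_succ (fun j => theta p (t ^ j * c l * x)) (ν.1 l)
  have h2 := Finset.prod_range_succ' (fun j => theta p (t ^ j * c l * x)) (ν.1 l)
  rw [h1] at h2
  have h3 : ∀ j, theta p (t * x * (t ^ j * c l)) = theta p (t ^ (j + 1) * c l * x) := by
    intro j
    rw [pow_succ, mul_comm t x, mul_assoc x, mul_comm x, ← mul_assoc t, mul_comm t]
  simp only [h3, mul_comm x]
  rw [h2, pow_zero, one_mul, mul_comm]

lemma plusTerm_refPoint {m s n : ℕ} {p t : ℂˣ} (hs : s ≤ m) (a : Fin m → ℂˣ)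
    {ν : Z s (n + 1)} {i : Fin (n + 1)} (h : IsLast ν i)
    (hreg : IsRegular p (refPoint t (initial s hs a) ν))
    (ht : theta p (t * refPoint t (initial s hs a) ν i ^ 2) ≠ 0) :
    plusTerm s p t a (refPoint t (initial s hs a) ν i)
      (i.removeNth (refPoint t (initial s hs a) ν)) = refCoeff p t hs a ν i := by
  have htel := telescope (p := p) (t := t) (initial s hs a) ν (refPoint t (initial s hs a) ν i)
  have hx2 := hreg.1 i
  have hne : ∀ j, theta p (refPoint t (initial s hs a) ν i *
      i.removeNth (refPoint t (initial s hs a) ν) j) ≠ 0 := fun j =>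
    (hreg.2 i _ (Fin.succAbove_ne i j).symm).1
  have hlast := h.t_mul t (initial s hs a)
  rw [refCoeff, plusTerm, prod_initial hs]
  rw [Fin.prod_univ_succAbove _ i, Fin.prod_univ_succAbove _ i,
    ← Finset.mul_prod_erase _ (fun l => theta p (t ^ ν.1 l * initial s hs a l *
      refPoint t (initial s hs a) ν i)) (Finset.mem_univ (ν.equiv i).1), ← hlast] at htel
  simp only [Fin.removeNth_apply] at hne ⊢
  change (∏ l, theta p (a (Fin.castLE hs l) * refPoint t (initial s hs a) ν i)) * _ = _ at htel
  generalize refPoint t (initial s hs a) ν = w at *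
  simp only [Finset.prod_div_distrib, Finset.prod_mul_distrib]
  have hne' : ∏ j, theta p (w i * w (i.succAbove j)) ≠ 0 :=
    Finset.prod_ne_zero_iff.2 fun j _ => hne j
  rw [mul_assoc t, ← sq] at htel
  -- Position i ends its string, so the end factor of that string is θ(t w_i²), which is also the
  -- term of i on the other side. It is cancelled using `ht`.
  have key : (∏ l, theta p (a (Fin.castLE hs l) * w i)) * ∏ j, theta p (t * w i * w (i.succAbove j)) =
      theta p (w i ^ 2) * (∏ j, theta p (w i * w (i.succAbove j))) *
        ∏ l ∈ Finset.univ.erase (ν.equiv i).1, theta p (t ^ ν.1 l * initial s hs a l * w i) := by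
    apply mul_left_cancel₀ ht
    linear_combination htel
  have hxn := (w i).ne_zero
  rw [div_mul_div_comm, mul_div_assoc']
  generalize ∏ j, theta p (t * w i * (w (i.succAbove j))⁻¹) = A at *
  generalize (∏ j, theta p (w i * (w (i.succAbove j))⁻¹)) = B at *
  rw [div_eq_mul_inv, div_eq_mul_inv]
  simp only [mul_inv]
  have h1 : (theta p (w i ^ 2))⁻¹ * (∏ j, theta p (w i * w (i.succAbove j)))⁻¹ *
    ((∏ l, theta p (a (Fin.castLE hs l) * w i)) * ∏ j, theta p (t * w i * w (i.succAbove j))) =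
      ∏ l ∈ Finset.univ.erase (ν.equiv i).1, theta p (t ^ ν.1 l * initial s hs a l * w i) := by
    rw [key]
    field_simp
  rw [← h1]
  ring

lemma coboundary_refPoint {m s n : ℕ} {p t : ℂˣ} (hs : s ≤ m) (a : Fin m → ℂˣ)
    {ν : Z s (n + 1)} (hreg : IsRegular p (refPoint t (initial s hs a) ν))
    (ht : ∀ i, theta p (t * refPoint t (initial s hs a) ν i ^ 2) ≠ 0) (φ : (Fin n → ℂˣ) → ℂ) :
    coboundary s p t a φ (refPoint t (initial s hs a) ν) = ∑ i, if IsLast ν i then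
      refCoeff p t hs a ν i * φ (i.removeNth (refPoint t (initial s hs a) ν)) else 0 := by
  refine Finset.sum_congr rfl fun i _ => ?_
  rw [coboundaryTerm, plusTerm_inv_eq_zero, add_zero]
  split_ifs with h
  · rw [plusTerm_refPoint hs a h hreg (ht i)]
  · rw [plusTerm_eq_zero_of_not_isLast _ _ h, zero_mul]

/-! ### Deformation of the parameters -/

/-- The weights of a balanced one-parameter deformation of the parameters. -/
def weight (s : ℕ) (k : ℕ) : ℤ := if k < s then 1 else if k < 2 * s then -1 else 0

/-- A balanced one-parameter deformation of the parameters. -/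
def deform {m : ℕ} (s : ℕ) (a : Fin m → ℂˣ) (r : ℂˣ) (k : Fin m) : ℂˣ := r ^ weight s k * a k

lemma sum_weight (s : ℕ) : ∑ k : Fin (2 * s + 2), weight s k = 0 := by
  rw [Fin.sum_univ_eq_sum_range (weight s) (2 * s + 2), Finset.sum_range_succ,
    Finset.sum_range_succ, two_mul, Finset.sum_range_add]
  have h1 : ∑ k ∈ Finset.range s, weight s k = s := by
    rw [Finset.sum_congr rfl fun k hk => show weight s k = 1 from
      if_pos (Finset.mem_range.1 hk)]
    simp
  have h2 : ∑ k ∈ Finset.range s, weight s (s + k) = -s := by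
    rw [Finset.sum_congr rfl fun k hk => show weight s (s + k) = -1 by
      have := Finset.mem_range.1 hk
      rw [weight, if_neg (by omega), if_pos (by omega)]]
    simp
  rw [h1, h2, weight, weight, if_neg (by omega), if_neg (by omega), if_neg (by omega),
    if_neg (by omega)]
  simp

lemma prod_deform (s : ℕ) (a : Fin (2 * s + 2) → ℂˣ) (r : ℂˣ) : ∏ k, deform s a r k = ∏ k, a k := by
  simp only [deform, Finset.prod_mul_distrib]
  have h : ∀ S : Finset (Fin (2 * s + 2)), ∏ k ∈ S, r ^ weight s k = r ^ ∑ k ∈ S, weight s k := by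
    intro S
    induction S using Finset.induction_on with
    | empty => simp
    | insert k S hk ih => rw [Finset.prod_insert hk, Finset.sum_insert hk, ih, zpow_add]
  rw [h, sum_weight, zpow_zero, one_mul]

lemma deform_one {m : ℕ} (s : ℕ) (a : Fin m → ℂˣ) : deform s a 1 = a := by
  ext k; simp [deform]

lemma refPoint_deform {m s n : ℕ} (t : ℂˣ) (hs : s ≤ m) (a : Fin m → ℂˣ) (r : ℂˣ) (ν : Z s n)
    (i : Fin n) :
    refPoint t (initial s hs (deform s a r)) ν i = r * refPoint t (initial s hs a) ν i := by
  rw [refPoint_apply, refPoint_apply, initial, initial, deform, weight, Fin.val_castLE,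
    if_pos (Fin.is_lt _), zpow_one, mul_left_comm]

section Limit

variable {p : ℂˣ} (hp : ‖(p : ℂ)‖ < 1)
include hp

lemma continuous_coboundary {m s n : ℕ} {t : ℂˣ} (a : Fin m → ℂˣ) (φ : (Fin n → ℂˣ) → ℂ)
    (z : Fin (n + 1) → ℂˣ) : Continuous fun r => coboundary s p t (deform s a r) φ z := by
  have hθ := continuous_theta hp
  have h : ∀ (x : ℂˣ) (w : Fin n → ℂˣ), Continuous fun r => plusTerm s p t (deform s a r) x w := by
    intro x w
    simp only [plusTerm, deform]
    refine Continuous.mul (Continuous.div_const (continuous_finsetProd _ fun k _ => ?_) _)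
      continuous_const
    exact hθ.comp (by fun_prop)
  simp only [coboundary, coboundaryTerm]
  exact continuous_finsetSum _ fun i _ => ((h _ _).add (h _ _)).mul continuous_const

/-- The deformation multiplies all coordinates by r, so the theta quotients, which involve only
ratios of coordinates, do not depend on r. -/
lemma continuous_refCoeff {m s n : ℕ} {t : ℂˣ} (hs : s ≤ m) (a : Fin m → ℂˣ)
    (ν : Z s (n + 1)) (i : Fin (n + 1)) :
    Continuous fun r => refCoeff p t hs (deform s a r) ν i := by
  have hθ := continuous_theta hp
  have hcanc : ∀ r x y : ℂˣ, r * x * (r * y)⁻¹ = x * y⁻¹ := fun r x y => by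
    rw [mul_inv, mul_mul_mul_comm, mul_inv_cancel, one_mul]
  have hcanc' : ∀ r x y : ℂˣ, t * (r * x) * (r * y)⁻¹ = t * x * y⁻¹ := fun r x y => by
    rw [mul_assoc, hcanc, mul_assoc]
  simp only [refCoeff, Fin.removeNth_apply, refPoint_deform, hcanc, hcanc']
  refine Continuous.mul (Continuous.mul (Continuous.mul ?_ ?_) ?_) continuous_const
  · simp only [← Units.val_pow_eq_pow_val, ← Units.val_inv_eq_inv_val]
    exact Units.continuous_val.comp (by fun_prop)
  · refine continuous_finsetProd _ fun k _ => hθ.comp ?_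
    simp only [deform]
    fun_prop
  · refine continuous_finsetProd _ fun k _ => hθ.comp ?_
    simp only [initial, deform]
    fun_prop

variable (h0 : ∃ u, theta p u ≠ 0)
include h0

lemma dense_forall_theta_sq_mul (Y : Finset ℂˣ) :
    Dense {r : ℂˣ | ∀ y ∈ Y, theta p (r ^ 2 * y) ≠ 0} := by
  refine dense_forall_ne_zero Y (f := fun y r => theta p (r ^ 2 * y))
    (fun y _ => ((isHol_theta hp).comp_mul_right y).comp_sq) fun y _ => ?_
  obtain ⟨u, hu⟩ := h0
  obtain ⟨v, hv⟩ := IsAlgClosed.exists_pow_nat_eq ((u * y⁻¹ : ℂˣ) : ℂ) two_pos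
  have hv0 : v ≠ 0 := by
    rintro rfl
    rw [zero_pow two_ne_zero] at hv
    exact (u * y⁻¹).ne_zero hv.symm
  refine ⟨Units.mk0 v hv0, ?_⟩
  have : (Units.mk0 v hv0) ^ 2 = u * y⁻¹ := Units.ext (by simpa using hv)
  simpa [this] using hu

/-- The coboundary of `φ` at an arbitrary reference point. -/
lemma symCoboundary_refPoint {d n : ℕ} {t : ℂˣ} {a : Fin (2 * (d + 1) + 2) → ℂˣ}
    (hbal : t ^ (2 * n) * ∏ k, a k = 1) (hs : d + 1 ≤ 2 * (d + 1) + 2)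
    {D : H p d n →ₗ[ℂ] H p d (n + 1)}
    (hD : ∀ (φ : H p d n) (z : Fin (n + 1) → ℂˣ), IsRegular p z →
      (D φ).1 z = coboundary (d + 1) p t a φ.1 z)
    {ν : Z (d + 1) (n + 1)}
    (hν : ∀ i j, i ≠ j → theta p (refPoint t (initial (d + 1) hs a) ν i *
      (refPoint t (initial (d + 1) hs a) ν j)⁻¹) ≠ 0) (φ : H p d n) :
    (D φ).1 (refPoint t (initial (d + 1) hs a) ν) = ∑ i, if IsLast ν i then
      refCoeff p t hs a ν i * φ.1 (i.removeNth (refPoint t (initial (d + 1) hs a) ν)) else 0 := by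
  classical
  set w := refPoint t (initial (d + 1) hs a) ν with hw
  obtain ⟨x, hx2, -, hx⟩ := exists_generic_seq hp h0 ∅
  have hx' : ∀ i j : Fin (d + (n + 1)), i ≠ j → e p (x i) (x j) ≠ 0 := fun i j hij =>
    hx i j (by simpa [Fin.ext_iff] using hij)
  let P := subsetPoint (d := d) (N := n + 1) fun i => x i
  have hP : ∀ S, IsRegular p (P S) := fun S => (isRegular_iff _).2
    ⟨fun i => hx2 _, fun i j hij => hx' _ _ ((Finset.orderEmbOfFin _ _).injective.ne hij)⟩
  let L := LinearEquiv.ofBijective _ (bijective_evalAt_subsetPoint hp h0 hx')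
  have hL : ∀ (f : H p d (n + 1)) S, L f S = f.1 (P S) := fun _ _ => rfl
  let u := fun S => L.symm (Pi.single S 1)
  -- Expansion in the basis dual to fixed regular points makes the dependence of the deformed
  -- coboundary on r explicit, hence continuous.
  have hexp : ∀ (f : H p d (n + 1)) z, f.1 z = ∑ S, f.1 (P S) * (u S).1 z := by
    intro f z
    have h1 : f = ∑ S, f.1 (P S) • u S := by
      apply L.injective
      ext T
      rw [map_sum, Finset.sum_apply, Finset.sum_eq_single T]
      · simp [u]
        rw [hL]
      · intro S _ hST
        simp [u, hST.symm]
      · simp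
    have h2 := congrArg (fun g : H p d (n + 1) => g.1 z) h1
    simpa using h2
  -- A is the deformed coboundary at the deformed reference point r w, and B is the proposed formula
  -- for it.
  let A : ℂˣ → ℂ := fun r => ∑ S, coboundary (d + 1) p t (deform (d + 1) a r) φ.1 (P S) *
    (u S).1 fun i => r * w i
  let B : ℂˣ → ℂ := fun r => ∑ i, if IsLast ν i then
      refCoeff p t hs (deform (d + 1) a r) ν i * φ.1 (fun j => r * i.removeNth w j) else 0
  have hA : Continuous A := continuous_finsetSum _ fun S _ =>
    (continuous_coboundary hp a _ _).mul ((u S).2.1.continuous.comp (by fun_prop))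
  have hB : Continuous B := continuous_finsetSum _ fun i _ => by
    split_ifs
    · exact (continuous_refCoeff hp hs a ν i).mul (φ.2.1.continuous.comp (by fun_prop))
    · exact continuous_const
  let Y : Finset ℂˣ := (Finset.univ.image fun ij : Fin (n + 1) × Fin (n + 1) => w ij.1 * w ij.2) ∪
    Finset.univ.image fun i => t * w i ^ 2
  -- For these r the point r w is regular: products of coordinates acquire a factor r², while ratios
  -- are unchanged and covered by `hν`. The set is dense, so A = B also at r = 1.
  have hAB : Set.EqOn A B {r : ℂˣ | ∀ y ∈ Y, theta p (r ^ 2 * y) ≠ 0} := by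
    intro r hr
    have hrw : refPoint t (initial (d + 1) hs (deform (d + 1) a r)) ν = fun i => r * w i :=
      funext fun i => refPoint_deform t hs a r ν i
    have hY1 : ∀ i j, theta p (r * w i * (r * w j)) ≠ 0 := fun i j => by
      have := hr (w i * w j) (Finset.mem_union_left _ (Finset.mem_image.2 ⟨(i, j), by simp⟩))
      rwa [sq, ← mul_mul_mul_comm] at this
    have hreg : IsRegular p fun i => r * w i := by
      refine ⟨fun i => by rw [sq]; exact hY1 i i, fun i j hij => ⟨hY1 i j, ?_⟩⟩
      rw [mul_inv, mul_mul_mul_comm, mul_inv_cancel, one_mul]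
      exact hν i j hij
    have ht : ∀ i, theta p (t * (r * w i) ^ 2) ≠ 0 := fun i => by
      have := hr (t * w i ^ 2) (Finset.mem_union_right _ (Finset.mem_image.2 ⟨i, by simp⟩))
      rwa [mul_left_comm, ← mul_pow] at this
    obtain ⟨D', hD'⟩ := exists_symCoboundary hp (t := t) (n := n) (a := deform (d + 1) a r)
      (by rw [prod_deform, hbal]) h0
    have h1 : A r = (D' φ).1 fun i => r * w i := by
      rw [hexp]
      exact Finset.sum_congr rfl fun S _ => by rw [hD' _ _ (hP S)]
    rw [h1, hD' _ _ hreg, ← hrw, coboundary_refPoint hs _ (by rwa [hrw]) (by simpa only [hrw] using ht),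
      hrw]
    rfl
  have h1 := hAB.closure hA hB
  rw [(dense_forall_theta_sq_mul hp h0 Y).closure_eq] at h1
  have h2 := h1 (Set.mem_univ 1)
  simp only [A, B, deform_one, one_mul] at h2
  rw [← h2, hexp]
  exact Finset.sum_congr rfl fun S _ => by rw [hD _ _ (hP S)]

end Limit


/-! ### Nonvanishing at generic parameters -/

lemma sigma_fin_ext {α : Type*} {f : α → ℕ} {x y : Σ k, Fin (f k)} (h : x.1 = y.1)
    (h' : (x.2 : ℕ) = y.2) : x = y := by
  obtain ⟨k, i⟩ := x
  obtain ⟨l, j⟩ := y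
  obtain rfl : k = l := h
  obtain rfl : i = j := Fin.ext h'
  rfl

section Generic

variable {p : ℂˣ} (hp : ‖(p : ℂ)‖ < 1)
include hp

lemma IsGeneric.e_ne_zero {s n : ℕ} {t : ℂˣ} {c : Fin s → ℂˣ} (hc : IsGeneric p t n c) {k l : Fin s}
    (hkl : k ≠ l) {i j : ℕ} (hij : i + j < n) : e p (t ^ i * c k) (t ^ j * c l) ≠ 0 := by
  rcases lt_or_gt_of_ne hkl with h | h
  · exact hc k l h i j hij
  · rw [e_swap hp, neg_ne_zero]
    exact hc l k h j i (by omega)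

lemma theta_pow_mul_inv_pow_ne_zero {t : ℂˣ} {n : ℕ}
    (ht : ∀ j, 1 ≤ j → j ≤ n → theta p (t ^ j) ≠ 0) {i j : ℕ} (hij : i ≠ j) (hi : i ≤ n)
    (hj : j ≤ n) : theta p (t ^ i * (t ^ j)⁻¹) ≠ 0 := by
  rcases lt_or_gt_of_ne hij with h | h
  · obtain ⟨k, rfl⟩ := Nat.exists_eq_add_of_lt h
    rw [show t ^ i * (t ^ (i + k + 1))⁻¹ = (t ^ (k + 1))⁻¹ by
      rw [add_assoc, pow_add t i, mul_inv, mul_inv_cancel_left], theta_inv hp]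
    exact mul_ne_zero (by simp) (ht _ (by omega) (by omega))
  · obtain ⟨k, rfl⟩ := Nat.exists_eq_add_of_lt h
    rw [add_assoc, pow_add, mul_right_comm, mul_inv_cancel, one_mul]
    exact ht _ (by omega) (by omega)

lemma IsGeneric.theta_ne_zero {s n : ℕ} {t : ℂˣ} {c : Fin s → ℂˣ} (hc : IsGeneric p t n c)
    (ht : ∀ j, 1 ≤ j → j ≤ n → theta p (t ^ j) ≠ 0) {k l : Fin s} {i j : ℕ} (hi : i ≤ n)
    (hj : j ≤ n) (h : k ≠ l → i + j < n) (h' : k = l → i ≠ j) :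
    theta p (t ^ i * c k * (t ^ j * c l)⁻¹) ≠ 0 := by
  rcases eq_or_ne k l with rfl | hkl
  · rw [mul_inv, mul_mul_mul_comm, mul_inv_cancel, mul_one]
    exact theta_pow_mul_inv_pow_ne_zero hp ht (h' rfl) hi hj
  · exact ((e_ne_zero_iff _ _).1 (hc.e_ne_zero hp hkl (h hkl))).2

variable {s n : ℕ} {t : ℂˣ} {c : Fin s → ℂˣ}

lemma IsGeneric.theta_refPoint_ne_zero (hc : IsGeneric p t n c)
    (ht : ∀ j, 1 ≤ j → j ≤ n → theta p (t ^ j) ≠ 0) (ν : Z s n) {i j : Fin n} (hij : i ≠ j) :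
    theta p (refPoint t c ν i * (refPoint t c ν j)⁻¹) ≠ 0 := by
  have hi := (ν.equiv i).2.2
  have hj := (ν.equiv j).2.2
  have hi' := ν.le (ν.equiv i).1
  have hj' := ν.le (ν.equiv j).1
  rw [refPoint_apply, refPoint_apply]
  refine hc.theta_ne_zero hp ht (by omega) (by omega) (fun hkl => ?_) fun hkl h => hij ?_
  · have := ν.add_le hkl
    omega
  · exact ν.equiv.injective (sigma_fin_ext hkl h)

/-- Moving the end of a string one step further gives an exponent that does not occur in that
string. -/
lemma IsGeneric.theta_t_mul_refPoint_ne_zero (hc : IsGeneric p t n c)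
    (ht : ∀ j, 1 ≤ j → j ≤ n → theta p (t ^ j) ≠ 0) {ν : Z s n} {i j : Fin n} (hi : IsLast ν i) :
    theta p (t * refPoint t c ν i * (refPoint t c ν j)⁻¹) ≠ 0 := by
  have hj := (ν.equiv j).2.2
  have hi' := ν.le (ν.equiv i).1
  have hj' := ν.le (ν.equiv j).1
  rw [hi.t_mul, refPoint_apply]
  refine hc.theta_ne_zero hp ht (by omega) (by omega) (fun hkl => ?_) fun hkl h => ?_
  · have := ν.add_le hkl
    omega
  · rw [hkl] at h
    omega

end Generic

/-! ### Injectivity of the coboundary operator -/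

lemma mset_removeNth_refPoint {s n : ℕ} (t : ℂˣ) (c : Fin s → ℂˣ) {ν : Z s (n + 1)} {i : Fin (n + 1)}
    (hi : IsLast ν i) {μ : Z s n} (hμ : μ.inc (ν.equiv i).1 = ν) :
    mset (i.removeNth (refPoint t c ν)) = mset (refPoint t c μ) := by
  have h1 := mset_refPoint_inc t c μ (ν.equiv i).1
  rw [hμ, ← mset_removeNth i] at h1
  have h2 : ν.1 (ν.equiv i).1 = μ.1 (ν.equiv i).1 + 1 := by
    rw [← μ.inc_self (ν.equiv i).1, hμ]
  have h3 : ((ν.equiv i).2 : ℕ) = μ.1 (ν.equiv i).1 := by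
    have h4 : ((ν.equiv i).2 : ℕ) + 1 = ν.1 (ν.equiv i).1 := hi
    omega
  rw [refPoint_apply, h3] at h1
  exact add_left_cancel h1

section Injective

variable {p : ℂˣ} (hp : ‖(p : ℂ)‖ < 1) {d n : ℕ} {t : ℂˣ} {a : Fin (2 * (d + 1) + 2) → ℂˣ}
  {hs : d + 1 ≤ 2 * (d + 1) + 2} (hc : IsGeneric p t (n + 1) (initial (d + 1) hs a))
  (ht : ∀ j, 1 ≤ j → j ≤ n + 1 → theta p (t ^ j) ≠ 0)
  (has : ∀ k : Fin (2 * (d + 1) + 2), d + 1 ≤ (k : ℕ) → ∀ u : ℕ, u < n + 1 →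
      theta p (t ^ u * initial (d + 1) hs a (Fin.last d) * a k) ≠ 0)
include hp hc ht has

/-- The point is t^u a_s with u < n + 1, so `has` handles the parameters beyond a_s. The other
factors are covered by genericity, as the entries of ν add up to n + 1. -/
lemma refCoeff_ne_zero {ν : Z (d + 1) (n + 1)} {i : Fin (n + 1)} (hi : IsLast ν i)
    (hl : (ν.equiv i).1 = Fin.last d) : refCoeff p t hs a ν i ≠ 0 := by
  have hi1 := (ν.equiv i).2.2
  have hi2 := ν.le (ν.equiv i).1
  refine mul_ne_zero (mul_ne_zero (mul_ne_zero (by simp) ?_) ?_) ?_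
  · refine Finset.prod_ne_zero_iff.2 fun k hk => ?_
    have h := has k (Finset.mem_filter.1 hk).2 ((ν.equiv i).2 : ℕ) (by omega)
    rwa [← hl, ← refPoint_apply, mul_comm] at h
  · refine Finset.prod_ne_zero_iff.2 fun l hl' => ?_
    rw [refPoint_apply]
    have hne := Finset.ne_of_mem_erase hl'
    have := ν.add_le hne
    exact ((e_ne_zero_iff _ _).1 (hc.e_ne_zero hp hne (by omega))).1
  · refine Finset.prod_ne_zero_iff.2 fun j _ => div_ne_zero ?_ ?_
    · exact hc.theta_t_mul_refPoint_ne_zero hp ht hi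
    · exact hc.theta_refPoint_ne_zero hp ht ν (Fin.succAbove_ne i j).symm

/-- An element whose coboundary vanishes on the hyperplanes `z_i = a_s` is zero. -/
theorem eq_zero_of_symCoboundary_eq_zero (hbal : t ^ (2 * n) * ∏ k, a k = 1)
    {D : H p d n →ₗ[ℂ] H p d (n + 1)}
    (hD : ∀ (φ : H p d n) (z : Fin (n + 1) → ℂˣ), IsRegular p z →
      (D φ).1 z = coboundary (d + 1) p t a φ.1 z) (φ : H p d n)
    (h : ∀ z, (∃ i, z i = initial (d + 1) hs a (Fin.last d)) → (D φ).1 z = 0) : φ = 0 := by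
  have h0 : ∃ u, theta p u ≠ 0 := ⟨_, ht 1 le_rfl (by omega)⟩
  refine Subtype.ext (eq_zero_of_refPoint hp h0 (c := initial (d + 1) hs a)
    (fun k l hkl i j hij => hc k l hkl i j (by omega)) φ.2 fun μ => ?_)
  -- Downward induction on the last entry of μ, evaluating the coboundary at μ + ε_s. That reference
  -- point contains a_s itself, so the left-hand side vanishes.
  induction hm : n - μ.1 (Fin.last d) using Nat.strong_induction_on generalizing μ with
  | _ m ih =>
  obtain ⟨ν, hν⟩ : ∃ ν, μ.inc (Fin.last d) = ν := ⟨_, rfl⟩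
  have hνl : ν.1 (Fin.last d) = μ.1 (Fin.last d) + 1 := by rw [← hν, Z.inc_self]
  have hsum := symCoboundary_refPoint hp h0 hbal hs hD
    (fun i j hij => hc.theta_refPoint_ne_zero hp ht ν hij) φ
  have hfirst : ∃ i, refPoint t (initial (d + 1) hs a) ν i = initial (d + 1) hs a (Fin.last d) := by
    refine ⟨ν.equiv.symm ⟨Fin.last d, ⟨0, by omega⟩⟩, ?_⟩
    rw [refPoint_apply, Equiv.apply_symm_apply, pow_zero, one_mul]
  rw [h _ hfirst] at hsum
  let i₀ := ν.equiv.symm ⟨Fin.last d, ⟨μ.1 (Fin.last d), by omega⟩⟩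
  have hi₀ : ν.equiv i₀ = ⟨Fin.last d, ⟨μ.1 (Fin.last d), by omega⟩⟩ := by simp [i₀]
  have hlast : IsLast ν i₀ := by
    rw [IsLast, hi₀]
    exact hνl.symm
  rw [Finset.sum_eq_single i₀, if_pos hlast, eq_comm, mul_eq_zero] at hsum
  · have h1 := hsum.resolve_left (refCoeff_ne_zero hp hc ht has hlast (by rw [hi₀]))
    rw [← h1]
    exact IsSym.eq_of_mset_eq φ.2.2.1
      (mset_removeNth_refPoint t _ hlast (by rw [hi₀]; exact hν)).symm
  · intro i _ hne
    split_ifs with hi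
    -- Any other contributing position ends a different string. Removing it keeps the last entry at
    -- μ_s + 1, where the induction hypothesis applies.
    · have hk : Fin.last d ≠ (ν.equiv i).1 := by
        intro hk
        refine hne (ν.equiv.injective ?_)
        rw [hi₀]
        have h4 : ((ν.equiv i).2 : ℕ) + 1 = ν.1 (ν.equiv i).1 := hi
        have h5 := congrArg ν.1 hk
        exact sigma_fin_ext hk.symm (show ((ν.equiv i).2 : ℕ) = μ.1 (Fin.last d) by omega)
      obtain ⟨μ', hμ'⟩ := ν.exists_inc (k := (ν.equiv i).1) ((Nat.zero_le _).trans_lt (ν.equiv i).2.2)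
      have h5 : μ'.1 (Fin.last d) = μ.1 (Fin.last d) + 1 := by
        rw [← hνl, ← μ'.inc_of_ne hk, hμ']
      have h6 := μ'.le (Fin.last d)
      rw [IsSym.eq_of_mset_eq φ.2.2.1 (mset_removeNth_refPoint t _ hi hμ'),
        ih _ (by omega) μ' rfl, mul_zero]
    · rfl
  · simp

end Injective

/-! ### The cokernel -/

section Cokernel

variable {p : ℂˣ} (hp : ‖(p : ℂ)‖ < 1) (h0 : ∃ u, theta p u ≠ 0)
include hp h0

/-- Multiplication by `∏ e(z_i, c)`. -/
def mulProdE (d N : ℕ) (c : ℂˣ) : H p d N →ₗ[ℂ] H p (d + 1) N where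
  toFun g := ⟨fun z => g.1 z * ∏ i, e p (z i) c, mul_prod_e_mem_H hp h0 g.2 c⟩
  map_add' _ _ := Subtype.ext (funext fun _ => add_mul _ _ _)
  map_smul' _ _ := Subtype.ext (funext fun _ => mul_assoc _ _ _)

lemma mulProdE_injective (d N : ℕ) (c : ℂˣ) : Injective (mulProdE hp h0 d N c) := by
  rw [← LinearMap.ker_eq_bot, LinearMap.ker_eq_bot']
  intro g hg
  obtain ⟨x, -, hxc, hx⟩ := exists_generic_seq hp h0 {c}
  refine Subtype.ext (funext fun z => SepTh.eq_zero_even hp (x := fun i : Fin (d + 1) => x i)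
    (fun i j hij => hx i j (by simpa [Fin.ext_iff] using hij)) (sepTh_of_mem_H g.2) (fun κ => ?_) z)
  have h1 : g.1 (fun i => x (κ i)) * ∏ i, e p (x (κ i)) c = 0 :=
    congrArg (fun f : H p (d + 1) N => f.1 fun i => x (κ i)) hg
  refine (mul_eq_zero.1 h1).resolve_right (Finset.prod_ne_zero_iff.2 fun i _ => ?_)
  rw [e_swap hp, neg_ne_zero]
  exact hxc _ c (by simp)

/-- If only `φ = 0` has an image `D φ` vanishing wherever some `z_i = c`, then multiplication by
`∏ e(z_i, c)` identifies `H p r (n + 1)` with the cokernel of `D`. -/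
theorem bijective_mkQ_mulProdE {r n : ℕ} {D : H p (r + 1) n →ₗ[ℂ] H p (r + 1) (n + 1)} {c : ℂˣ}
    (hD : ∀ φ, (∀ z, (∃ i, z i = c) → (D φ).1 z = 0) → φ = 0) :
    Bijective ((LinearMap.range D).mkQ ∘ₗ mulProdE hp h0 r (n + 1) c) := by
  have := finiteDimensional_H hp h0 r (n + 1)
  have := finiteDimensional_H hp h0 (r + 1) (n + 1)
  have hDinj : Injective D := by
    rw [← LinearMap.ker_eq_bot, LinearMap.ker_eq_bot']
    exact fun φ hφ => hD φ fun z _ => by rw [hφ]; rfl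
  have hinj : Injective ((LinearMap.range D).mkQ ∘ₗ mulProdE hp h0 r (n + 1) c) := by
    rw [← LinearMap.ker_eq_bot, LinearMap.ker_eq_bot']
    intro g hg
    rw [LinearMap.comp_apply, Submodule.mkQ_apply, Submodule.Quotient.mk_eq_zero] at hg
    obtain ⟨φ, hφ⟩ := hg
    -- A coboundary that is a multiple of ∏ e(z_i, c) vanishes wherever z_i = c, so the hypothesis
    -- on D applies.
    have hφ0 : φ = 0 := hD φ fun z ⟨i, hi⟩ => by
      rw [hφ]
      change g.1 z * ∏ i, e p (z i) c = 0
      rw [Finset.prod_eq_zero (Finset.mem_univ i) (by rw [hi, e_self]), mul_zero]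
    refine mulProdE_injective hp h0 r (n + 1) c ?_
    rw [← hφ, hφ0, map_zero, map_zero]
  refine ⟨hinj, (LinearMap.injective_iff_surjective_of_finrank_eq_finrank ?_).1 hinj⟩
  -- Pascal's rule for `multichoose` gives the cokernel of the injective D the same dimension as
  -- H_{r,n+1}.
  have h1 := Submodule.finrank_quotient_add_finrank (LinearMap.range D)
  rw [LinearMap.finrank_range_of_inj hDinj, finrank_H hp h0, finrank_H hp h0,
    Nat.multichoose_succ_succ] at h1
  rw [finrank_H hp h0]
  omega

/-- Two elements of `H p d N` agreeing at the regular points are equal. -/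
lemma eq_of_forall_isRegular {d N : ℕ} {f g : H p d N}
    (h : ∀ z, IsRegular p z → f.1 z = g.1 z) : f = g := by
  obtain ⟨x, hx2, -, hx⟩ := exists_generic_seq hp h0 ∅
  have hx' : ∀ i j : Fin (d + N), i ≠ j → e p (x i) (x j) ≠ 0 := fun i j hij =>
    hx i j (by simpa [Fin.ext_iff] using hij)
  refine (bijective_evalAt_subsetPoint hp h0 hx').1 (funext fun S => h _ ((isRegular_iff _).2
    ⟨fun i => hx2 _, fun i j hij => hx' _ _ ((Finset.orderEmbOfFin _ _).injective.ne hij)⟩))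

end Cokernel

end EllipticBC
end

/-- The number of variables is `n + 1`, with `n : ℕ`. -/
theorem theorem3p2 (s n : ℕ) (hs : 2 ≤ s) (p t : ℂˣ) (hp : ‖(p : ℂ)‖ < 1) (ht : ‖(t : ℂ)‖ < 1)
    (a : Fin (2 * s + 2) → ℂˣ)
    (balancing : t ^ (2 * (n + 1) - 2) * ∏ k, a k = 1)
    (generic_t : ∀ j : ℕ, 1 ≤ j → j ≤ n + 1 → EllipticBC.theta p (t ^ j) ≠ 0)
    (generic_a : EllipticBC.IsGeneric p t (n + 1)
      (EllipticBC.initial s (by omega : s ≤ 2 * s + 2) a))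
    (generic_as : ∀ k : Fin (2 * s + 2), s ≤ (k : ℕ) → ∀ u : ℕ, u < n + 1 →
      EllipticBC.theta p (t ^ u * a ⟨s - 1, by omega⟩ * a k) ≠ 0) :
    (∃! E : Module.Basis (EllipticBC.Z (s - 1) (n + 1)) ℂ (EllipticBC.H p (s - 2) (n + 1)),
      EllipticBC.IsInterpolationBasis t
        (EllipticBC.initial (s - 1) (by omega : s - 1 ≤ 2 * s + 2) a) E) ∧
    (∃! D : EllipticBC.H p (s - 1) n →ₗ[ℂ] EllipticBC.H p (s - 1) (n + 1),
      EllipticBC.IsSymCoboundary s p t a D) ∧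
    ∀ (E : Module.Basis (EllipticBC.Z (s - 1) (n + 1)) ℂ (EllipticBC.H p (s - 2) (n + 1)))
      (D : EllipticBC.H p (s - 1) n →ₗ[ℂ] EllipticBC.H p (s - 1) (n + 1)),
      EllipticBC.IsInterpolationBasis t
        (EllipticBC.initial (s - 1) (by omega : s - 1 ≤ 2 * s + 2) a) E →
      EllipticBC.IsSymCoboundary s p t a D →
      (∃ b : Module.Basis (EllipticBC.Z (s - 1) (n + 1)) ℂ (EllipticBC.Cohomology D),
        ∀ ν, ∃ ψ : EllipticBC.H p (s - 1) (n + 1),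
          (∀ z, ψ.1 z = (E ν).1 z * ∏ i, EllipticBC.e p (z i) (a ⟨s - 1, by omega⟩)) ∧
          b ν = Submodule.Quotient.mk ψ) ∧
      Module.finrank ℂ (EllipticBC.Cohomology D) = ((n + 1) + s - 2).choose (s - 2) := by
  obtain ⟨r, rfl⟩ := Nat.exists_eq_add_of_le' hs
  -- That θ is not identically zero is read off from θ(t) ≠ 0.
  have h0 : ∃ u, EllipticBC.theta p u ≠ 0 := ⟨_, generic_t 1 le_rfl (by omega)⟩
  have hbal : t ^ (2 * n) * ∏ k, a k = 1 := balancing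
  refine ⟨?_, ?_, fun E D _ hD => ?_⟩
  · exact EllipticBC.existsUnique_interpolationBasis hp h0 (d := r) fun k l hkl i j hij =>
      generic_a k.castSucc l.castSucc hkl i j hij
  · obtain ⟨D, hD⟩ := EllipticBC.exists_symCoboundary hp hbal h0 (d := r + 1)
    refine ⟨D, fun φ z hz => ?_, fun D' hD' => ?_⟩
    · rw [← EllipticBC.coboundary_eq]
      exact hD φ z hz
    · refine LinearMap.ext fun φ => EllipticBC.eq_of_forall_isRegular hp h0 fun z hz => ?_
      rw [hD' φ z hz, ← EllipticBC.coboundary_eq]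
      exact (hD φ z hz).symm
  · have hbij := EllipticBC.bijective_mkQ_mulProdE hp h0 (r := r) (D := D)
      (c := a ⟨r + 1, by omega⟩) fun φ h =>
        EllipticBC.eq_zero_of_symCoboundary_eq_zero hp (d := r + 1) generic_a generic_t generic_as
          hbal (fun φ z hz => (hD φ z hz).trans (EllipticBC.coboundary_eq _ _ _ _ _ _).symm) φ h
    -- This isomorphism carries any basis of H_{s-2} to a basis of the cokernel, in particular the
    -- interpolation basis.
    let L := LinearEquiv.ofBijective _ hbij
    refine ⟨⟨E.map L, fun ν => ⟨EllipticBC.mulProdE hp h0 r (n + 1) _ (E ν), fun z => rfl, rfl⟩⟩, ?_⟩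
    refine L.finrank_eq.symm.trans ?_
    rw [EllipticBC.finrank_H hp h0, Nat.multichoose_eq,
      show r + 1 + (n + 1) - 1 = r + (n + 1) by omega, ← Nat.choose_symm_add]
    congr 1
    omega
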